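/- All graphs here are finite unless said otherwise, and $\|G\|$ is the number of edges of $G$. An $H$-packing of $G$ is a set of pairwise edge-disjoint subgraphs of $G$, each isomorphic to $H$; it is maximal if no other $H$-packing of $G$ properly contains it. Let $\mathrm{cl}(G,H)$ be the minimum size of a maximal $H$-packing of $G$. For $k\in\{3,4,6\}$ let $R_k$ be the infinite graph formed by the vertices and edges of the tiling of the Euclidean plane by regular $k$-gons of side length one (triangular, square, hexagonal), placed so that $(0,0)$ and $(1,0)$ are joined by an edge, and let $R_k(n)$ be the subgraph of $R_k$ induced by the vertices in $[0,n)\times[0,n)$; in particular $R_4(n)$ is the $n\times n$ square grid $Gr_n$. (i) For each $k\in\{3,4,6\}$ the following limit exists and has the stated value: $$\lim_{n\to\infty}\frac{k\cdot\mathrm{cl}(R_k(n),C_k)}{\|R_k(n)\|}=\frac{2}{k+1}.$$ (ii) In particular, $\mathrm{cl}(Gr_n,C_4)=\frac{n^2}{5}(1+o(1))$ as $n\to\infty$. (iii) For every fixed integer $d\ge 2$, as $n\to\infty$, $$\frac{d^2-d}{4d^2-4d-3}\cdot\frac{\|R_4(n)\|}{\|R_4(d)\|}\,(1-o(1))\le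 \mathrm{cl}(R_4(n),R_4(d))\le\frac{d^2-d}{4d^2-8d+5}\cdot\frac{\|R_4(n)\|}{\|R_4(d)\|}\,(1+o(1)).$$ -/

import Mathlib

open Filter Topology Asymptotics

/-! ### Packings -/

namespace ClumsyPacking

variable {V W : Type*}

/-- A subgraph `S` of `G` is a copy of `H` if it is isomorphic to `H`. -/
def IsCopy (G : SimpleGraph V) (H : SimpleGraph W) (S : G.Subgraph) : Prop :=
  Nonempty (H ≃g S.coe)

/-- An `H`-packing of `G`: a set of pairwise edge-disjoint copies of `H` in `G`. -/
def IsPacking (G : SimpleGraph V) (H : SimpleGraph W) (P : Set G.Subgraph) : Prop :=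
  (∀ S ∈ P, IsCopy G H S) ∧
    ∀ S ∈ P, ∀ T ∈ P, S ≠ T → Disjoint S.edgeSet T.edgeSet

/-- An `H`-packing of `G` that is not properly contained in another `H`-packing of `G`. -/
def IsMaximalPacking (G : SimpleGraph V) (H : SimpleGraph W) (P : Set G.Subgraph) : Prop :=
  Maximal (IsPacking G H) P

/-- `cl G H`: the size of a clumsy `H`-packing of the (finite) graph `G`, that is the minimum
number of elements of a maximal `H`-packing of `G`. -/
noncomputable def cl (G : SimpleGraph V) (H : SimpleGraph W) : ℕ :=
  sInf {m : ℕ | ∃ P : Set G.Subgraph, IsMaximalPacking G H P ∧ P.encard = m}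

/-- The number of edges of a (finite) graph, written `||G||`. -/
noncomputable def numEdges (G : SimpleGraph V) : ℕ :=
  G.edgeSet.ncard

/-- In a finite graph the minimum that defines `cl` is attained. -/
theorem exists_clumsy [Finite V] (G : SimpleGraph V) (H : SimpleGraph W) :
    ∃ P : Set G.Subgraph, IsMaximalPacking G H P ∧ P.encard = cl G H := by
  have hfin : {P : Set G.Subgraph | IsPacking G H P}.Finite := Set.toFinite _
  obtain ⟨P, hP⟩ := hfin.exists_maximal ⟨∅, by simp [IsPacking]⟩
  have hne : {m : ℕ | ∃ P : Set G.Subgraph, IsMaximalPacking G H P ∧ P.encard = m}.Nonempty :=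
    ⟨P.ncard, P, hP, ((Set.toFinite P).cast_ncard_eq).symm⟩
  exact Nat.sInf_mem hne

/-! ### The regular tilings of the plane -/

/-- The Euclidean plane. -/
abbrev Plane : Type := EuclideanSpace ℝ (Fin 2)

/-- The point `a • (1, 0) + b • (1/2, √3/2)` of the triangular lattice of side one. -/
noncomputable def triPoint (a b : ℤ) : Plane :=
  !₂[(a : ℝ) + (b : ℝ) / 2, (b : ℝ) * (√3 / 2)]

/-- The vertices of the tiling of the plane by regular `k`-gons of side one (`k = 3, 4, 6`) that
has an edge from `(0, 0)` to `(1, 0)`: the triangular lattice for `k = 3`, the points with integer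
coordinates for `k = 4`; for `k = 6` the triangular lattice without the centres of the hexagons,
which form one of the three cosets of the sublattice `{triPoint a b | 3 ∣ a - b}`, namely the one
that contains `(-1, 0)`. (For other `k` there is no such tiling, and the set is empty.) -/
def tilingVertices : ℕ → Set Plane
  | 3 => {p | ∃ a b : ℤ, p = triPoint a b}
  | 4 => {p | ∃ a b : ℤ, p = !₂[(a : ℝ), (b : ℝ)]}
  | 6 => {p | ∃ a b : ℤ, ¬ a - b ≡ -1 [ZMOD 3] ∧ p = triPoint a b}
  | _ => ∅

/-- The infinite graph `R_k`: two vertices of the tiling are adjacent if they are the ends of a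
side of a tile, that is if their distance is one. -/
def tilingGraph (k : ℕ) : SimpleGraph (tilingVertices k) where
  Adj p q := dist (p : Plane) (q : Plane) = 1
  symm := ⟨fun p q h => by rw [dist_comm]; exact h⟩
  loopless := ⟨fun p h => by simp at h⟩

/-- The vertices of `R_k` in the half-open square `[0, n) × [0, n)`. -/
def tilingWindow (k n : ℕ) : Set (tilingVertices k) :=
  {p | ∀ i : Fin 2, (p : Plane) i ∈ Set.Ico (0 : ℝ) n}

/-- The finite piece `R_k(n)`: the subgraph of `R_k` induced by the vertices in
`[0, n) × [0, n)`. For `k = 4` this is the `n × n` square grid. -/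
def tiling (k n : ℕ) : SimpleGraph (tilingWindow k n) :=
  (tilingGraph k).induce (tilingWindow k n)

end ClumsyPacking

namespace ClumsyPacking

/-! ### Bounds on the size of clumsy packings -/

section Bounds

variable {V W ι : Type*} [Finite V]

/-! Call two copies of `H` in conflict if they share an edge, so that a copy with an edge conflicts
with itself. A maximal packing is an independent dominating set of the conflict relation. If each
copy conflicts with at most `D` copies, a maximal packing therefore has at least (number of copies)
/ `D` members (`ncard_le_mul_cl`). Conversely, take a periodic packing of the plane that dominates
all copies. Restricted to the window and extended to a maximal packing, it gains only copies whose
dominating members stick out of the window, and these lie near the boundary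
(`cl_le_ncard_add_ncard`). The two bounds agree asymptotically when the periodic packing is a
perfect code, that is, when every copy conflicts with exactly one member.

All tilings are put into coordinates in `ℤ × ℤ`, where the windows form Følner sequences. Boundary
terms then vanish and only densities per lattice point matter (`IsPattern.exists_tendsto_bounds`):
triangles have density 2 and `D = 4`, with a perfect code modulo 4, giving 1/2 against 3 edges;
hexagons have density 1/3 and `D = 7`, with a perfect code modulo 21, giving 1/21 against 1 edge; `d
× d` blocks, with `c = d - 1`, have density 1 and `D = (2c+1)² - 4`, and the sublattice `x ≡ 2cy`
modulo `4c² + 1` is a dominating packing, against 2 edges. For `d = 2` both numbers are 5 and the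
block is `C_4`.

What remains is to determine all copies: `isPattern_tri` and `isPattern_hex` reduce this to finite
checks, and `isPattern_grid` shows that embedded grids are rigid. -/

theorem cl_congr {V W W' : Type*} (G : SimpleGraph V) {H : SimpleGraph W} {H' : SimpleGraph W'}
    (φ : H ≃g H') : cl G H = cl G H' := by
  have h : IsPacking G H = IsPacking G H' := by
    funext P
    have hc : ∀ S, IsCopy G H S ↔ IsCopy G H' S := fun S =>
      ⟨fun ⟨f⟩ => ⟨φ.symm.trans f⟩, fun ⟨f⟩ => ⟨φ.trans f⟩⟩
    simp only [IsPacking, hc]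
  simp only [cl, IsMaximalPacking, h]

/-- If every position is in conflict with at most `D` positions, then the number of positions is
at most `D` times the size of a clumsy packing. -/
theorem ncard_le_mul_cl (G : SimpleGraph V) (H : SimpleGraph W) (A : Set ι)
    (sub : ι → G.Subgraph)
    (hcls : ∀ S, IsCopy G H S → ∃ i ∈ A, S = sub i)
    (hcopy : ∀ i ∈ A, IsCopy G H (sub i))
    (hne : ∀ i ∈ A, (sub i).edgeSet.Nonempty)
    (N : ι → Finset ι) (D : ℕ) (hD : ∀ i, (N i).card ≤ D)
    (hN : ∀ i ∈ A, ∀ j ∈ A, ¬ Disjoint (sub i).edgeSet (sub j).edgeSet → i ∈ N j) :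
    A.ncard ≤ D * cl G H := by
  classical
  rcases A.eq_empty_or_nonempty with rfl | ⟨i₀, -⟩
  · simp
  have : Nonempty ι := ⟨i₀⟩
  obtain ⟨P, hP, hcard⟩ := exists_clumsy G H
  have hPfin : P.Finite := Set.toFinite P
  have hPn : P.ncard = cl G H := by
    have := hPfin.cast_ncard_eq
    rw [hcard] at this
    exact_mod_cast this
  choose! g hgA hg using hcls
  -- A copy disjoint from all members could be added to `P`. It is not already a member, since its
  -- edge set is nonempty and so not disjoint from itself.
  have hcov : ∀ i ∈ A, ∃ T ∈ P, ¬ Disjoint (sub i).edgeSet T.edgeSet := by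
    intro i hi
    by_contra! hcon
    have hmem : sub i ∉ P := fun h => by
      have := hcon _ h
      rw [disjoint_self] at this
      exact (hne i hi).ne_empty this
    have hins : IsPacking G H (insert (sub i) P) := by
      refine ⟨?_, ?_⟩
      · rintro S (rfl | hS)
        · exact hcopy i hi
        · exact hP.prop.1 S hS
      · rintro S (rfl | hS) T (rfl | hT) hST
        · exact absurd rfl hST
        · exact hcon _ hT
        · exact (hcon _ hS).symm
        · exact hP.prop.2 S hS T hT hST
    exact hmem (hP.le_of_ge hins (Set.subset_insert _ _) (Set.mem_insert _ _))
  have hsub : A ⊆ ((hPfin.toFinset.biUnion fun T => N (g T) : Finset ι) : Set ι) := by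
    intro i hi
    obtain ⟨T, hT, hdis⟩ := hcov i hi
    have hTc := hP.prop.1 T hT
    rw [hg T hTc] at hdis
    simp only [Finset.coe_biUnion, Set.mem_iUnion]
    exact ⟨T, by simpa using hT, hN i hi _ (hgA T hTc) hdis⟩
  calc A.ncard ≤ (hPfin.toFinset.biUnion fun T => N (g T)).card := by
        rw [← Set.ncard_coe_finset]
        exact Set.ncard_le_ncard hsub (Finset.finite_toSet _)
    _ ≤ hPfin.toFinset.card * D := Finset.card_biUnion_le_card_mul _ _ _ fun T _ => hD _
    _ = D * cl G H := by rw [← Set.ncard_eq_toFinset_card P hPfin, hPn, mul_comm]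

/-- A clumsy packing is at most as large as a given packing together with all positions that are
not in conflict with it. -/
theorem cl_le_ncard_add_ncard (G : SimpleGraph V) (H : SimpleGraph W) (A L : Set ι) (hA : A.Finite)
    (sub : ι → G.Subgraph)
    (hcls : ∀ S, IsCopy G H S → ∃ i ∈ A, S = sub i)
    (hcopy : ∀ i ∈ A, IsCopy G H (sub i))
    (hL : ∀ i ∈ A ∩ L, ∀ j ∈ A ∩ L, i ≠ j → Disjoint (sub i).edgeSet (sub j).edgeSet) :
    cl G H ≤ (A ∩ L).ncard +
      {i ∈ A | ∀ j ∈ A ∩ L, Disjoint (sub i).edgeSet (sub j).edgeSet}.ncard := by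
  have hpack : IsPacking G H (sub '' (A ∩ L)) := by
    refine ⟨?_, ?_⟩
    · rintro _ ⟨i, hi, rfl⟩
      exact hcopy i hi.1
    · rintro _ ⟨i, hi, rfl⟩ _ ⟨j, hj, rfl⟩ hij
      exact hL i hi j hj fun h => hij (by rw [h])
  obtain ⟨P, hle, hP⟩ := (Set.toFinite {P | IsPacking G H P}).exists_le_maximal hpack
  have hsub : P ⊆ sub '' (A ∩ L) ∪
      sub '' {i ∈ A | ∀ j ∈ A ∩ L, Disjoint (sub i).edgeSet (sub j).edgeSet} := by
    intro S hS
    by_cases h : S ∈ sub '' (A ∩ L)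
    · exact Or.inl h
    · obtain ⟨i, hi, rfl⟩ := hcls S (hP.prop.1 S hS)
      refine Or.inr ⟨i, ⟨hi, fun j hj => ?_⟩, rfl⟩
      have hj' : sub j ∈ sub '' (A ∩ L) := ⟨j, hj, rfl⟩
      exact hP.prop.2 _ hS _ (hle hj') fun heq => h (heq ▸ hj')
  have hcl : cl G H ≤ P.ncard := Nat.sInf_le ⟨P, hP, ((Set.toFinite P).cast_ncard_eq).symm⟩
  refine hcl.trans ((Set.ncard_le_ncard hsub (Set.toFinite _)).trans ?_)
  refine (Set.ncard_union_le _ _).trans (add_le_add ?_ ?_)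
  · exact Set.ncard_image_le (hA.subset Set.inter_subset_left)
  · exact Set.ncard_image_le (hA.subset (Set.sep_subset _ _))

end Bounds

/-! ### Densities with respect to a Følner sequence in `ℤ × ℤ` -/

/-- A sequence of finite subsets of `ℤ × ℤ` whose boundaries are negligible. -/
structure IsFolner (W : ℕ → Set (ℤ × ℤ)) : Prop where
  finite : ∀ n, (W n).Finite
  pos : ∀ᶠ n in atTop, 0 < (W n).ncard
  boundary : ∀ u : ℤ × ℤ,
    Tendsto (fun n => ({p ∈ W n | p + u ∉ W n}.ncard : ℝ) / (W n).ncard) atTop (𝓝 0)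

/-- The subset `S` of `ℤ × ℤ` has density `δ` along the sequence `W`. -/
def HasDensity (W : ℕ → Set (ℤ × ℤ)) (S : Set (ℤ × ℤ)) (δ : ℝ) : Prop :=
  Tendsto (fun n => ({p ∈ W n | p ∈ S}.ncard : ℝ) / (W n).ncard) atTop (𝓝 δ)

/-- The vectors `u` with negligible boundary form a subgroup of `ℤ × ℤ`, so two generators suffice.
-/
theorem isFolner_of_generators {W : ℕ → Set (ℤ × ℤ)} (hfin : ∀ n, (W n).Finite)
    (hpos : ∀ᶠ n in atTop, 0 < (W n).ncard)
    (h₁ : Tendsto (fun n => ({p ∈ W n | p + (1, 0) ∉ W n}.ncard : ℝ) / (W n).ncard) atTop (𝓝 0))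
    (h₂ : Tendsto (fun n => ({p ∈ W n | p + (0, 1) ∉ W n}.ncard : ℝ) / (W n).ncard) atTop (𝓝 0)) :
    IsFolner W := by
  refine ⟨hfin, hpos, ?_⟩
  let S : AddSubgroup (ℤ × ℤ) :=
    { carrier := {u | Tendsto (fun n => ({p ∈ W n | p + u ∉ W n}.ncard : ℝ) / (W n).ncard)
        atTop (𝓝 0)}
      zero_mem' := by
        simp
      add_mem' := by
        intro u v hu hv
        have hle : ∀ n, {p ∈ W n | p + (u + v) ∉ W n}.ncard ≤
            {p ∈ W n | p + u ∉ W n}.ncard + {p ∈ W n | p + v ∉ W n}.ncard := by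
          intro n
          have hsub : {p ∈ W n | p + (u + v) ∉ W n} ⊆ {p ∈ W n | p + u ∉ W n} ∪
              (fun p => p - u) '' {p ∈ W n | p + v ∉ W n} := by
            rintro p ⟨hp, hq⟩
            by_cases h : p + u ∈ W n
            · exact Or.inr ⟨p + u, ⟨h, by rwa [add_assoc]⟩, by simp⟩
            · exact Or.inl ⟨hp, h⟩
          have f₁ : {p ∈ W n | p + u ∉ W n}.Finite := (hfin n).subset (Set.sep_subset _ _)
          have f₂ : {p ∈ W n | p + v ∉ W n}.Finite := (hfin n).subset (Set.sep_subset _ _)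
          exact (Set.ncard_le_ncard hsub (f₁.union (f₂.image _))).trans
            ((Set.ncard_union_le _ _).trans (add_le_add le_rfl (Set.ncard_image_le f₂)))
        have hsum := Tendsto.add hu hv
        rw [add_zero] at hsum
        refine squeeze_zero (fun n => by positivity) (fun n => ?_) hsum
        rw [← add_div]
        gcongr
        exact_mod_cast hle n
      neg_mem' := by
        intro u hu
        -- Translation by `u` matches the points that stay in `W n` under `u` with those that stay
        -- under `-u`, so the complements in `W n` have equal size.
        have heq : ∀ n, {p ∈ W n | p + -u ∉ W n}.ncard = {p ∈ W n | p + u ∉ W n}.ncard := by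
          intro n
          have e₁ := Set.ncard_sdiff_add_ncard_of_subset
            (s := {p ∈ W n | p + -u ∈ W n}) (t := W n) (Set.sep_subset _ _) (hfin n)
          have e₂ := Set.ncard_sdiff_add_ncard_of_subset
            (s := {p ∈ W n | p + u ∈ W n}) (t := W n) (Set.sep_subset _ _) (hfin n)
          have e₃ : {p ∈ W n | p + -u ∈ W n}.ncard = {p ∈ W n | p + u ∈ W n}.ncard := by
            have : {p ∈ W n | p + -u ∈ W n} = (fun p => p + u) '' {p ∈ W n | p + u ∈ W n} := by
              ext p
              simp only [Set.mem_ofPred_eq, Set.mem_image]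
              constructor
              · rintro ⟨hp, hq⟩
                exact ⟨p + -u, ⟨hq, by simpa using hp⟩, by simp⟩
              · rintro ⟨q, ⟨hq, hp⟩, rfl⟩
                exact ⟨hp, by simpa using hq⟩
            rw [this, Set.ncard_image_of_injective _ (add_left_injective u)]
          have d₁ : W n \ {p ∈ W n | p + -u ∈ W n} = {p ∈ W n | p + -u ∉ W n} := by
            ext p; simp +contextual
          have d₂ : W n \ {p ∈ W n | p + u ∈ W n} = {p ∈ W n | p + u ∉ W n} := by
            ext p; simp +contextual
          rw [d₁] at e₁
          rw [d₂] at e₂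
          omega
        simp only [Set.mem_ofPred_eq] at hu ⊢
        simpa only [heq] using hu }
  have hx : ((1, 0) : ℤ × ℤ) ∈ S := h₁
  have hy : ((0, 1) : ℤ × ℤ) ∈ S := h₂
  rintro ⟨a, b⟩
  have : ((a, b) : ℤ × ℤ) = a • ((1, 0) : ℤ × ℤ) + b • ((0, 1) : ℤ × ℤ) := by ext <;> simp
  have hm : ((a, b) : ℤ × ℤ) ∈ S := this ▸ S.add_mem (S.zsmul_mem hx a) (S.zsmul_mem hy b)
  exact hm

namespace IsFolner

variable {W : ℕ → Set (ℤ × ℤ)}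

theorem hasDensity_univ (hW : IsFolner W) : HasDensity W Set.univ 1 := by
  refine Tendsto.congr' ?_ tendsto_const_nhds
  filter_upwards [hW.pos] with n hn
  have : ((W n).ncard : ℝ) ≠ 0 := by positivity
  simp [this]

/-- The residue classes of a surjective homomorphism to `ℤ / M` have density `1 / M`. -/
theorem hasDensity_residue (hW : IsFolner W) {M : ℕ} [NeZero M] (f : ℤ × ℤ →+ ZMod M)
    (hf : Function.Surjective f) (r : ZMod M) : HasDensity W {p | f p = r} (1 / M) := by
  set c : ZMod M → ℕ → ℕ := fun s n => {p ∈ W n | p ∈ {p | f p = s}}.ncard with hc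
  -- Translation by `u` carries class `s` into class `s + f u`, except for points that leave the
  -- window. Surjectivity of `f` thus makes all classes asymptotically equal in size.
  have hle : ∀ s u n, c s n ≤ c (s + f u) n + {p ∈ W n | p + u ∉ W n}.ncard := by
    intro s u n
    have f₁ : {p ∈ W n | p ∈ {p | f p = s + f u}}.Finite := (hW.finite n).subset (Set.sep_subset _ _)
    have f₂ : {p ∈ W n | p + u ∉ W n}.Finite := (hW.finite n).subset (Set.sep_subset _ _)
    have hsub : {p ∈ W n | p ∈ {p | f p = s}} ⊆
        (fun p => p - u) '' {p ∈ W n | p ∈ {p | f p = s + f u}} ∪ {p ∈ W n | p + u ∉ W n} := by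
      rintro p ⟨hp, hs⟩
      by_cases h : p + u ∈ W n
      · refine Or.inl ⟨p + u, ⟨h, ?_⟩, by simp⟩
        simp only [Set.mem_ofPred_eq] at hs ⊢
        rw [map_add, hs]
      · exact Or.inr ⟨hp, h⟩
    exact (Set.ncard_le_ncard hsub ((f₁.image _).union f₂)).trans
      ((Set.ncard_union_le _ _).trans (add_le_add (Set.ncard_image_le f₁) le_rfl))
  have hdiff : ∀ s, Tendsto (fun n => ((c r n : ℝ) - c s n) / (W n).ncard) atTop (𝓝 0) := by
    intro s
    obtain ⟨u, hu⟩ := hf (s - r)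
    have hsum := (hW.boundary u).add (hW.boundary (-u))
    rw [add_zero] at hsum
    refine squeeze_zero_norm (fun n => ?_) hsum
    have h₁ := hle r u n
    have h₂ := hle s (-u) n
    rw [hu, add_sub_cancel] at h₁
    rw [map_neg, hu, neg_sub, add_sub_cancel] at h₂
    have h₁' : (c r n : ℝ) ≤ c s n + {p ∈ W n | p + u ∉ W n}.ncard := by exact_mod_cast h₁
    have h₂' : (c s n : ℝ) ≤ c r n + {p ∈ W n | p + -u ∉ W n}.ncard := by exact_mod_cast h₂
    have i₁ : (0 : ℝ) ≤ {p ∈ W n | p + u ∉ W n}.ncard := by positivity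
    have i₂ : (0 : ℝ) ≤ {p ∈ W n | p + -u ∉ W n}.ncard := by positivity
    rw [norm_div, Real.norm_natCast, ← add_div, Real.norm_eq_abs]
    gcongr
    rw [abs_le]
    constructor <;> linarith
  have htot : ∀ n, ∑ s, c s n = (W n).ncard := by
    intro n
    classical
    rw [Set.ncard_eq_toFinset_card _ (hW.finite n),
      Finset.card_eq_sum_card_fiberwise (f := f) (t := Finset.univ) (fun x _ => Finset.mem_univ _)]
    refine Finset.sum_congr rfl fun s _ => ?_
    rw [← Set.ncard_coe_finset]
    simp only [hc]
    congr 1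
    ext p
    simp
  have hM : (M : ℝ) ≠ 0 := Nat.cast_ne_zero.2 (NeZero.ne M)
  have hlim : Tendsto (fun n => (M : ℝ) * ((c r n : ℝ) / (W n).ncard)) atTop (𝓝 1) := by
    -- Summing `c r n - c s n` over all `s` gives `M * c r n` minus the size of the window.
    have hs := tendsto_finsetSum (Finset.univ : Finset (ZMod M)) fun s _ => hdiff s
    simp only [Finset.sum_const_zero] at hs
    have hs' := hs.const_add 1
    rw [add_zero] at hs'
    refine hs'.congr' ?_
    filter_upwards [hW.pos] with n hn
    have hn' : ((W n).ncard : ℝ) ≠ 0 := by positivity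
    rw [← Finset.sum_div, Finset.sum_sub_distrib, Finset.sum_const, ← Nat.cast_sum, htot n]
    simp only [Finset.card_univ, ZMod.card, nsmul_eq_mul]
    field_simp
    ring
  have hlim' := hlim.const_mul (1 / (M : ℝ))
  rw [mul_one] at hlim'
  refine hlim'.congr fun n => ?_
  field_simp
  rfl

/-- Restricting a set to the points whose translates by a given finite set lie in the window does
not change its density. -/
theorem tendsto_interior (hW : IsFolner W) {S : Set (ℤ × ℤ)} {δ : ℝ} (hS : HasDensity W S δ)
    (T : Finset (ℤ × ℤ)) :
    Tendsto (fun n => ({p ∈ W n | p ∈ S ∧ ∀ u ∈ T, p + u ∈ W n}.ncard : ℝ) / (W n).ncard)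
      atTop (𝓝 δ) := by
  have hb := tendsto_finsetSum T fun u _ => hW.boundary u
  simp only [Finset.sum_const_zero] at hb
  have hlow := Tendsto.sub hS hb
  rw [sub_zero] at hlow
  refine tendsto_of_tendsto_of_tendsto_of_le_of_le hlow hS (fun n => ?_) (fun n => ?_)
  · have f₁ : {p ∈ W n | p ∈ S ∧ ∀ u ∈ T, p + u ∈ W n}.Finite :=
      (hW.finite n).subset (Set.sep_subset _ _)
    have hsub : {p ∈ W n | p ∈ S} ⊆ {p ∈ W n | p ∈ S ∧ ∀ u ∈ T, p + u ∈ W n} ∪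
        ⋃ u ∈ T, {p ∈ W n | p + u ∉ W n} := by
      rintro p ⟨hp, hs⟩
      by_cases h : ∀ u ∈ T, p + u ∈ W n
      · exact Or.inl ⟨hp, hs, h⟩
      · push Not at h
        obtain ⟨u, hu, hu'⟩ := h
        exact Or.inr (Set.mem_biUnion hu ⟨hp, hu'⟩)
    have f₂ : (⋃ u ∈ T, {p ∈ W n | p + u ∉ W n}).Finite :=
      (hW.finite n).subset (by simp +contextual [Set.iUnion_subset_iff])
    have h₁ := (Set.ncard_le_ncard hsub (f₁.union f₂)).trans (Set.ncard_union_le _ _)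
    have h₂ : (⋃ u ∈ T, {p ∈ W n | p + u ∉ W n}).ncard ≤ ∑ u ∈ T, {p ∈ W n | p + u ∉ W n}.ncard :=
      Finset.set_ncard_biUnion_le _ _
    rw [← Finset.sum_div, ← sub_div]
    gcongr
    rw [sub_le_iff_le_add]
    have h₃ := h₁.trans (add_le_add le_rfl h₂)
    have h₄ := (Nat.cast_le (α := ℝ)).2 h₃
    rw [Nat.cast_add, Nat.cast_sum] at h₄
    exact h₄
  · gcongr
    · exact (hW.finite n).subset (Set.sep_subset _ _)
    · exact And.left

end IsFolner

end ClumsyPacking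

namespace ClumsyPacking

/-! ### Graphs labelled by lattice points -/

/-- The quadratic form `x² + t x y + y²` on `ℤ × ℤ`. -/
def latNorm (t : ℤ) (p : ℤ × ℤ) : ℤ := p.1 ^ 2 + t * p.1 * p.2 + p.2 ^ 2

/-- The graph on `ℤ × ℤ` in which two points are adjacent if their difference has norm one: the
square grid for `t = 0`, the triangular lattice for `t = 1`. -/
def latGraph (t : ℤ) : SimpleGraph (ℤ × ℤ) where
  Adj p q := latNorm t (q - p) = 1
  symm := ⟨fun p q h => by
    rw [← h]
    simp only [latNorm, Prod.fst_sub, Prod.snd_sub]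
    ring⟩
  loopless := ⟨fun p h => by simp [latNorm] at h⟩

theorem latGraph_adj {t : ℤ} {p q : ℤ × ℤ} : (latGraph t).Adj p q ↔ latNorm t (q - p) = 1 := Iff.rfl

instance (t : ℤ) : DecidableRel (latGraph t).Adj := fun p q =>
  inferInstanceAs (Decidable (latNorm t (q - p) = 1))

theorem latGraph_adj_sub {t : ℤ} (p q r : ℤ × ℤ) :
    (latGraph t).Adj (p - r) (q - r) ↔ (latGraph t).Adj p q := by
  simp [latGraph_adj]

theorem latGraph_adj_add {t : ℤ} (p q r : ℤ × ℤ) :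
    (latGraph t).Adj (p + r) (q + r) ↔ (latGraph t).Adj p q := by
  simp [latGraph_adj]

/-- The map `e` identifies `G` with the subgraph of `latGraph t` that is induced by the points
of `W` in `K`. -/
structure IsLabelling {V : Type*} (t : ℤ) (K W : Set (ℤ × ℤ)) (G : SimpleGraph V)
    (e : V → ℤ × ℤ) : Prop where
  injective : Function.Injective e
  adj : ∀ x y, G.Adj x y ↔ (latGraph t).Adj (e x) (e y)
  range : ∀ p, (∃ v, e v = p) ↔ p ∈ W ∧ p ∈ K

namespace IsLabelling

variable {V : Type*} {t : ℤ} {K W : Set (ℤ × ℤ)} {G : SimpleGraph V} {e : V → ℤ × ℤ}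

theorem finite (he : IsLabelling t K W G e) (hW : W.Finite) : Finite V :=
  Set.finite_univ_iff.1 (Set.Finite.of_finite_image
    (hW.subset (by rintro _ ⟨v, -, rfl⟩; exact ((he.range _).1 ⟨v, rfl⟩).1)) he.injective.injOn)

/-- Count darts by direction: a dart is determined by its tail and by a unit vector `u`, and each
edge carries two darts. -/
theorem two_mul_numEdges (he : IsLabelling t K W G e) (hW : W.Finite) (U : Finset (ℤ × ℤ))
    (hU : ∀ u, latNorm t u = 1 ↔ u ∈ U) :
    2 * numEdges G = ∑ u ∈ U, {p ∈ W | p ∈ K ∧ p + u ∈ K ∧ p + u ∈ W}.ncard := by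
  classical
  have := he.finite hW
  have := Fintype.ofFinite V
  have hE : numEdges G = G.edgeFinset.card := by
    rw [numEdges, ← SimpleGraph.coe_edgeFinset, Set.ncard_coe_finset]
  rw [hE, ← SimpleGraph.dart_card_eq_twice_card_edges, ← Finset.card_univ,
    Finset.card_eq_sum_card_fiberwise (f := fun d : G.Dart => e d.snd - e d.fst) (t := U)
      (fun d _ => (hU _).1 ((he.adj _ _).1 d.adj))]
  refine Finset.sum_congr rfl fun u hu => ?_
  rw [← Set.ncard_coe_finset]
  refine Set.ncard_congr (fun d _ => e d.fst) ?_ ?_ ?_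
  · intro d hd
    simp only [Finset.coe_filter, Finset.mem_univ, true_and, Set.mem_ofPred_eq] at hd
    have h₁ := (he.range _).1 ⟨d.fst, rfl⟩
    have h₂ := (he.range _).1 ⟨d.snd, rfl⟩
    have h₃ : e d.fst + u = e d.snd := by rw [← hd]; abel
    exact ⟨h₁.1, h₁.2, h₃ ▸ h₂.2, h₃ ▸ h₂.1⟩
  · intro d d' hd hd' h
    simp only [Finset.coe_filter, Finset.mem_univ, true_and, Set.mem_ofPred_eq] at hd hd'
    have h₁ : d.fst = d'.fst := he.injective h
    have h₂ : d.snd = d'.snd := by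
      apply he.injective
      rw [← hd', h] at hd
      exact sub_left_injective hd
    exact SimpleGraph.Dart.ext _ _ (Prod.ext h₁ h₂)
  · rintro p ⟨hp, hpK, hqK, hq⟩
    obtain ⟨x, rfl⟩ := (he.range _).2 ⟨hp, hpK⟩
    obtain ⟨y, hy⟩ := (he.range _).2 ⟨hq, hqK⟩
    have hxy : G.Adj x y := by
      rw [he.adj, latGraph_adj, hy, add_sub_cancel_left]
      exact (hU u).2 hu
    exact ⟨⟨(x, y), hxy⟩, by simp [hy], rfl⟩

end IsLabelling

theorem tendsto_numEdges {V : ℕ → Type*} {t : ℤ} {K : Set (ℤ × ℤ)} {W : ℕ → Set (ℤ × ℤ)}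
    (hW : IsFolner W) {G : ∀ n, SimpleGraph (V n)} {e : ∀ n, V n → ℤ × ℤ}
    (he : ∀ n, IsLabelling t K (W n) (G n) (e n)) (U : Finset (ℤ × ℤ))
    (hU : ∀ u, latNorm t u = 1 ↔ u ∈ U) (δ : ℝ)
    (hK : ∀ u ∈ U, HasDensity W {p | p ∈ K ∧ p + u ∈ K} δ) :
    Tendsto (fun n => (numEdges (G n) : ℝ) / (W n).ncard) atTop (𝓝 (U.card * δ / 2)) := by
  have h := tendsto_finsetSum U fun u hu => hW.tendsto_interior (hK u hu) {u}
  rw [Finset.sum_const, nsmul_eq_mul] at h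
  refine (h.div_const 2).congr fun n => ?_
  have h₂ := (he n).two_mul_numEdges (hW.finite n) U hU
  have h₃ : (numEdges (G n) : ℝ) =
      (∑ u ∈ U, ({p ∈ W n | p ∈ K ∧ p + u ∈ K ∧ p + u ∈ W n}.ncard : ℝ)) / 2 := by
    rw [eq_div_iff two_ne_zero, mul_comm]
    exact_mod_cast h₂
  rw [h₃, ← Finset.sum_div, div_right_comm]
  simp [and_assoc]

/-! ### Copies in lattice graphs -/

/-- With templates `F`, the copies of shape `s` at `0` and of shape `s'` at `o` share an edge. -/
def Conflict {σ : Type*} (t : ℤ) (F : σ → Finset (ℤ × ℤ)) (s s' : σ) (o : ℤ × ℤ) : Prop :=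
  ∃ a ∈ F s, ∃ b ∈ F s, (latGraph t).Adj a b ∧ a - o ∈ F s' ∧ b - o ∈ F s'

instance {σ : Type*} (t : ℤ) (F : σ → Finset (ℤ × ℤ)) (s s' : σ) (o : ℤ × ℤ) :
    Decidable (Conflict t F s s' o) := by
  unfold Conflict
  infer_instance

/-- The copies of `H` in the subgraph of `latGraph t` induced by `K` are the subgraphs that are
induced by the translates `p + F s` with `p ∈ C s`. -/
structure IsPattern {X σ : Type*} (H : SimpleGraph X) (t : ℤ) (K : Set (ℤ × ℤ))
    (F : σ → Finset (ℤ × ℤ)) (C : σ → Set (ℤ × ℤ)) : Prop where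
  zero_mem : ∀ s, 0 ∈ F s
  subset : ∀ s, ∀ p ∈ C s, ∀ v ∈ F s, p + v ∈ K
  shape : ∀ s, ∃ f : X → ℤ × ℤ, Function.Injective f ∧ (∀ q, (∃ a, f a = q) ↔ q ∈ F s) ∧
    ∀ a b, H.Adj a b ↔ (latGraph t).Adj (f a) (f b)
  classify : ∀ f : X → ℤ × ℤ, Function.Injective f →
    (∀ a b, H.Adj a b → (latGraph t).Adj (f a) (f b)) → (∀ a, f a ∈ K) →
    ∃ s, ∃ p ∈ C s, (∀ q, (∃ a, f a = q) ↔ q - p ∈ F s) ∧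
      ∀ a b, (latGraph t).Adj (f a) (f b) → H.Adj a b

/-- The positions of the copies that lie in the window `W`. -/
def positions {σ : Type*} (F : σ → Finset (ℤ × ℤ)) (C : σ → Set (ℤ × ℤ)) (W : Set (ℤ × ℤ)) :
    Set ((ℤ × ℤ) × σ) :=
  {i | i.1 ∈ C i.2 ∧ ∀ u ∈ F i.2, i.1 + u ∈ W}

/-- The subgraph at a given position. -/
def subAt {V σ : Type*} (G : SimpleGraph V) (e : V → ℤ × ℤ) (F : σ → Finset (ℤ × ℤ))
    (i : (ℤ × ℤ) × σ) : G.Subgraph :=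
  (⊤ : G.Subgraph).induce {v | e v - i.1 ∈ F i.2}

theorem ncard_eq_sum_ncard_fibers {α σ : Type*} [Fintype σ] {B : Set (α × σ)} (hB : B.Finite) :
    B.ncard = ∑ s, {p | (p, s) ∈ B}.ncard := by
  classical
  rw [Set.ncard_eq_toFinset_card _ hB,
    Finset.card_eq_sum_card_fiberwise (f := Prod.snd) (t := Finset.univ)
      (fun x _ => Finset.mem_univ _)]
  refine Finset.sum_congr rfl fun s _ => ?_
  rw [← Set.ncard_coe_finset]
  refine Set.ncard_congr (fun i _ => i.1) ?_ ?_ ?_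
  · rintro ⟨p, s'⟩ h
    simp only [Finset.coe_filter, Set.Finite.mem_toFinset, Set.mem_ofPred_eq] at h ⊢
    exact h.2 ▸ h.1
  · rintro ⟨p, s₁⟩ ⟨q, s₂⟩ h₁ h₂ h
    simp only [Finset.coe_filter, Set.Finite.mem_toFinset, Set.mem_ofPred_eq] at h₁ h₂ h
    rw [h, h₁.2, h₂.2]
  · intro p hp
    exact ⟨(p, s), by simpa using hp, rfl⟩

namespace IsPattern

variable {V X σ : Type*} {H : SimpleGraph X} {t : ℤ} {K W : Set (ℤ × ℤ)}
  {F : σ → Finset (ℤ × ℤ)} {C : σ → Set (ℤ × ℤ)} {G : SimpleGraph V} {e : V → ℤ × ℤ}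

theorem fst_mem (hH : IsPattern H t K F C) {i : (ℤ × ℤ) × σ} (hi : i ∈ positions F C W) :
    i.1 ∈ W := by
  simpa using hi.2 0 (hH.zero_mem _)

theorem finite_positions [Finite σ] (hH : IsPattern H t K F C) (hW : W.Finite) :
    (positions F C W).Finite :=
  (hW.prod Set.finite_univ).subset fun _ hi => ⟨hH.fst_mem hi, Set.mem_univ _⟩

theorem isCopy_subAt (hH : IsPattern H t K F C) (he : IsLabelling t K W G e)
    {i : (ℤ × ℤ) × σ} (hi : i ∈ positions F C W) : IsCopy G H (subAt G e F i) := by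
  obtain ⟨p, s⟩ := i
  obtain ⟨f, hf, hr, hadj⟩ := hH.shape s
  have hex : ∀ a, ∃ v, e v = f a + p := fun a => by
    have ha := (hr _).1 ⟨a, rfl⟩
    rw [he.range, add_comm]
    exact ⟨hi.2 _ ha, hH.subset _ _ hi.1 _ ha⟩
  choose g hg using hex
  have hmem : ∀ a, g a ∈ (subAt G e F (p, s)).verts := fun a => by
    change e (g a) - p ∈ F s
    rw [hg, add_sub_cancel_right]
    exact (hr _).1 ⟨a, rfl⟩
  refine ⟨⟨Equiv.ofBijective (fun a => ⟨g a, hmem a⟩) ⟨?_, ?_⟩, ?_⟩⟩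
  · intro a b hab
    have h : g a = g b := congrArg Subtype.val hab
    have h' := congrArg e h
    rw [hg, hg] at h'
    exact hf (add_left_injective _ h')
  · rintro ⟨v, hv⟩
    obtain ⟨a, ha⟩ := (hr (e v - p)).2 hv
    refine ⟨a, Subtype.ext (he.injective ?_)⟩
    rw [hg, ha, sub_add_cancel]
  · intro a b
    have h : (subAt G e F (p, s)).Adj (g a) (g b) ↔ G.Adj (g a) (g b) :=
      ⟨fun h => h.adj_sub, fun h => ⟨hmem a, hmem b, h⟩⟩
    change (subAt G e F (p, s)).Adj (g a) (g b) ↔ H.Adj a b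
    rw [h, he.adj, hg, hg, latGraph_adj_add, hadj]

/-- By `classify` a copy has no missing chords, so it is an induced subgraph and its vertex set
determines it. -/
theorem exists_eq_subAt (hH : IsPattern H t K F C) (he : IsLabelling t K W G e)
    (S : G.Subgraph) (hS : IsCopy G H S) : ∃ i ∈ positions F C W, S = subAt G e F i := by
  obtain ⟨φ⟩ := hS
  obtain ⟨s, p, hp, hr, hadj⟩ := hH.classify (fun a => e (φ a))
    (fun a b h => φ.injective (Subtype.ext (he.injective h)))
    (fun a b h => (he.adj _ _).1 (φ.map_adj_iff.2 h).adj_sub)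
    (fun a => ((he.range _).1 ⟨_, rfl⟩).2)
  have hverts : ∀ v, v ∈ S.verts ↔ e v - p ∈ F s := by
    intro v
    rw [← hr]
    constructor
    · intro hv
      exact ⟨φ.symm ⟨v, hv⟩, by simp⟩
    · rintro ⟨a, ha⟩
      rw [← he.injective ha]
      exact (φ a).2
  refine ⟨(p, s), ⟨hp, fun u hu => ?_⟩, ?_⟩
  · obtain ⟨a, ha⟩ := (hr (p + u)).2 (by simpa using hu)
    rw [← ha]
    exact ((he.range _).1 ⟨_, rfl⟩).1
  · refine SimpleGraph.Subgraph.ext (Set.ext hverts) ?_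
    ext x y
    constructor
    · intro h
      exact ⟨(hverts x).1 h.fst_mem, (hverts y).1 h.snd_mem, h.adj_sub⟩
    · rintro ⟨hx, hy, h⟩
      have hx' := (hverts x).2 hx
      have hy' := (hverts y).2 hy
      have hH' : H.Adj (φ.symm ⟨x, hx'⟩) (φ.symm ⟨y, hy'⟩) := by
        apply hadj
        simpa using (he.adj x y).1 h
      have h₂ := φ.map_adj_iff.2 hH'
      simpa using h₂

/-- Only `i` has to lie in the window: a shared edge of the templates is an edge of the copy at `i`,
hence present in `G`. -/
theorem not_disjoint_subAt (hH : IsPattern H t K F C) (he : IsLabelling t K W G e)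
    {i j : (ℤ × ℤ) × σ} (hi : i ∈ positions F C W) :
    ¬ Disjoint (subAt G e F i).edgeSet (subAt G e F j).edgeSet ↔
      Conflict t F i.2 j.2 (j.1 - i.1) := by
  rw [Set.not_disjoint_iff]
  constructor
  · rintro ⟨x, hx, hy⟩
    induction x with
    | _ x y =>
      rw [SimpleGraph.Subgraph.mem_edgeSet] at hx hy
      obtain ⟨h₁, h₂, h₃⟩ := hx
      obtain ⟨h₄, h₅, -⟩ := hy
      refine ⟨_, h₁, _, h₂, ?_, ?_, ?_⟩
      · rw [latGraph_adj_sub, ← he.adj]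
        exact h₃
      · rw [sub_sub_sub_cancel_right]
        exact h₄
      · rw [sub_sub_sub_cancel_right]
        exact h₅
  · rintro ⟨a, ha, b, hb, hab, ha', hb'⟩
    obtain ⟨x, hx⟩ := (he.range (i.1 + a)).2 ⟨hi.2 _ ha, hH.subset _ _ hi.1 _ ha⟩
    obtain ⟨y, hy⟩ := (he.range (i.1 + b)).2 ⟨hi.2 _ hb, hH.subset _ _ hi.1 _ hb⟩
    have hG : G.Adj x y := by
      rw [he.adj, hx, hy, add_comm, add_comm i.1, latGraph_adj_add]
      exact hab
    refine ⟨s(x, y), ⟨?_, ?_, hG⟩, ⟨?_, ?_, hG⟩⟩ <;>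
      simp only [Set.mem_ofPred_eq, hx, hy, add_sub_cancel_left, ha, hb]
    · convert ha' using 1; abel
    · convert hb' using 1; abel

/-- Conflict is translation invariant, so one finite list of offsets per shape bounds the number of
conflicts at every position. -/
theorem sum_ncard_le_mul_cl [Fintype σ] (hH : IsPattern H t K F C) (he : IsLabelling t K W G e)
    (hW : W.Finite) (hne : ∃ a b, H.Adj a b) (N : σ → Finset ((ℤ × ℤ) × σ)) (D : ℕ)
    (hD : ∀ s, (N s).card ≤ D) (hN : ∀ s s' o, Conflict t F s s' o → (o, s) ∈ N s') :
    ∑ s, {p ∈ W | p ∈ C s ∧ ∀ u ∈ F s, p + u ∈ W}.ncard ≤ D * cl G H := by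
  classical
  have := he.finite hW
  have hself : ∀ s, Conflict t F s s 0 := by
    intro s
    obtain ⟨f, -, hr, hadj⟩ := hH.shape s
    obtain ⟨a, b, hab⟩ := hne
    have ha := (hr _).1 ⟨a, rfl⟩
    have hb := (hr _).1 ⟨b, rfl⟩
    exact ⟨f a, ha, f b, hb, (hadj a b).1 hab, by simpa using ha, by simpa using hb⟩
  have h := ncard_le_mul_cl G H (positions F C W) (subAt G e F)
    (hH.exists_eq_subAt he) (fun i hi => hH.isCopy_subAt he hi)
    (fun i hi => by
      by_contra hemp
      rw [Set.not_nonempty_iff_eq_empty] at hemp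
      refine (hH.not_disjoint_subAt he (j := i) hi).2 ?_ (by rw [hemp]; exact disjoint_bot_left)
      rw [sub_self]
      exact hself _)
    -- An offset runs from the conflicting position to `j`, so it is subtracted from `j.1`.
    (fun j => (N j.2).image fun o => (j.1 - o.1, o.2)) D
    (fun j => Finset.card_image_le.trans (hD _))
    (fun i hi j hj hij => by
      rw [hH.not_disjoint_subAt he hi] at hij
      exact Finset.mem_image.2 ⟨_, hN _ _ _ hij, by simp⟩)
  rw [ncard_eq_sum_ncard_fibers (hH.finite_positions hW)] at h
  refine le_trans (le_of_eq (Finset.sum_congr rfl fun s _ => congrArg _ ?_)) h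
  ext p
  exact ⟨fun hp => hp.2, fun hp => ⟨hH.fst_mem (i := (p, s)) hp, hp⟩⟩

/-- `L` is the periodic packing. A position that meets no member inside the window is still in
conflict with some member of `L`, which must stick out. Hence some `p + u` with `u ∈ T` lies outside
the window, and such `p` are counted by the second sum. -/
theorem cl_le_sum_ncard [Fintype σ] (hH : IsPattern H t K F C) (he : IsLabelling t K W G e)
    (hW : W.Finite) (L : σ → Set (ℤ × ℤ)) (T : Finset (ℤ × ℤ))
    (hL : ∀ s s' p q, p ∈ L s → q ∈ L s' → Conflict t F s s' (q - p) → s = s' ∧ p = q)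
    (hT : ∀ s, ∀ p ∈ C s, ∃ s', ∃ q ∈ C s', q ∈ L s' ∧ Conflict t F s s' (q - p) ∧
      ∀ v ∈ F s', q + v - p ∈ T) :
    cl G H ≤ ∑ s, {p ∈ W | p ∈ L s}.ncard +
      (∑ u ∈ T, {p ∈ W | p + u ∉ W}.ncard) * Fintype.card σ := by
  have := he.finite hW
  have hfin := hH.finite_positions hW
  refine (cl_le_ncard_add_ncard G H (positions F C W) {i | i.1 ∈ L i.2} hfin (subAt G e F)
    (hH.exists_eq_subAt he) (fun i hi => hH.isCopy_subAt he hi) ?_).trans (add_le_add ?_ ?_)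
  · rintro ⟨p, s⟩ hi ⟨q, s'⟩ hj hij
    by_contra hdis
    rw [hH.not_disjoint_subAt he hi.1] at hdis
    obtain ⟨h₁, h₂⟩ := hL _ _ _ _ hi.2 hj.2 hdis
    simp only at h₁ h₂
    exact hij (by rw [h₁, h₂])
  · rw [ncard_eq_sum_ncard_fibers (hfin.subset Set.inter_subset_left)]
    refine Finset.sum_le_sum fun s _ => Set.ncard_le_ncard ?_ (hW.subset (Set.sep_subset _ _))
    rintro p ⟨hp, hpL⟩
    exact ⟨hH.fst_mem hp, hpL⟩
  · have hfb : (⋃ u ∈ T, {p ∈ W | p + u ∉ W}).Finite :=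
      hW.subset (by simp +contextual [Set.iUnion_subset_iff])
    have hsub : {i ∈ positions F C W | ∀ j ∈ positions F C W ∩ {i | i.1 ∈ L i.2},
        Disjoint (subAt G e F i).edgeSet (subAt G e F j).edgeSet} ⊆
        (⋃ u ∈ T, {p ∈ W | p + u ∉ W}) ×ˢ (Set.univ : Set σ) := by
      rintro ⟨p, s⟩ ⟨hi, hdis⟩
      refine ⟨?_, Set.mem_univ _⟩
      obtain ⟨s', q, hqC, hqL, hconf, hqT⟩ := hT s p hi.1
      have hq : (q, s') ∉ positions F C W := fun hq =>
        (hH.not_disjoint_subAt he (j := (q, s')) hi).2 hconf (hdis _ ⟨hq, hqL⟩)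
      have hq' : ¬ ∀ v ∈ F s', q + v ∈ W := fun h => hq ⟨hqC, h⟩
      push Not at hq'
      obtain ⟨v, hv, hv'⟩ := hq'
      exact Set.mem_biUnion (hqT v hv) ⟨hH.fst_mem hi, by simpa using hv'⟩
    refine (Set.ncard_le_ncard hsub (hfb.prod Set.finite_univ)).trans ?_
    rw [Set.ncard_prod, Set.ncard_univ, Nat.card_eq_fintype_card]
    exact Nat.mul_le_mul_right _ (Finset.set_ncard_biUnion_le _ _)

/-- Asymptotic bounds for the size of clumsy packings along a Følner sequence. -/
theorem exists_tendsto_bounds [Fintype σ] (hH : IsPattern H t K F C) (hne : ∃ a b, H.Adj a b)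
    {V : ℕ → Type*} {W : ℕ → Set (ℤ × ℤ)} (hW : IsFolner W) {G : ∀ n, SimpleGraph (V n)}
    {e : ∀ n, V n → ℤ × ℤ} (he : ∀ n, IsLabelling t K (W n) (G n) (e n))
    (N : σ → Finset ((ℤ × ℤ) × σ)) (D : ℕ) (hD₀ : 0 < D) (hD : ∀ s, (N s).card ≤ D)
    (hN : ∀ s s' o, Conflict t F s s' o → (o, s) ∈ N s')
    (L : σ → Set (ℤ × ℤ)) (T : Finset (ℤ × ℤ))
    (hL : ∀ s s' p q, p ∈ L s → q ∈ L s' → Conflict t F s s' (q - p) → s = s' ∧ p = q)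
    (hT : ∀ s, ∀ p ∈ C s, ∃ s', ∃ q ∈ C s', q ∈ L s' ∧ Conflict t F s s' (q - p) ∧
      ∀ v ∈ F s', q + v - p ∈ T)
    {α l : ℝ} (hα : ∀ s, HasDensity W (C s) α) (hl : ∀ s, HasDensity W (L s) l) :
    ∃ lo hi : ℕ → ℝ, Tendsto lo atTop (𝓝 (Fintype.card σ * α / D)) ∧
      Tendsto hi atTop (𝓝 (Fintype.card σ * l)) ∧
      ∀ n, lo n ≤ (cl (G n) H : ℝ) / (W n).ncard ∧ (cl (G n) H : ℝ) / (W n).ncard ≤ hi n := by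
  have hlo := (tendsto_finsetSum (Finset.univ : Finset σ) fun s _ =>
    hW.tendsto_interior (hα s) (F s)).div_const (D : ℝ)
  have hhi := (tendsto_finsetSum (Finset.univ : Finset σ) fun s _ => hl s).add
    ((tendsto_finsetSum T fun u _ => hW.boundary u).mul_const (Fintype.card σ : ℝ))
  rw [Finset.sum_const, nsmul_eq_mul, Finset.card_univ] at hlo hhi
  rw [Finset.sum_const_zero, zero_mul, add_zero] at hhi
  refine ⟨_, _, hlo, hhi, fun n => ⟨?_, ?_⟩⟩
  · have h := (Nat.cast_le (α := ℝ)).2 (hH.sum_ncard_le_mul_cl (he n) (hW.finite n) hne N D hD hN)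
    rw [Nat.cast_sum, Nat.cast_mul] at h
    rw [div_le_iff₀ (by positivity), ← Finset.sum_div, div_mul_eq_mul_div, mul_comm _ (D : ℝ)]
    gcongr
  · have h := (Nat.cast_le (α := ℝ)).2 (hH.cl_le_sum_ncard (he n) (hW.finite n) L T hL hT)
    rw [Nat.cast_add, Nat.cast_mul, Nat.cast_sum, Nat.cast_sum] at h
    rw [← Finset.sum_div, ← Finset.sum_div, div_mul_eq_mul_div, ← add_div]
    gcongr

end IsPattern

end ClumsyPacking

namespace ClumsyPacking

/-! ### The windows of the tilings -/

/-- The point `(a, b)` of the square lattice. -/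
noncomputable def gridPoint (a b : ℤ) : Plane := !₂[(a : ℝ), (b : ℝ)]

theorem gridPoint_injective : Function.Injective fun p : ℤ × ℤ => gridPoint p.1 p.2 := by
  rintro ⟨a, b⟩ ⟨c, d⟩ h
  have h₀ := congrArg (fun x : Plane => x 0) h
  have h₁ := congrArg (fun x : Plane => x 1) h
  simp only [gridPoint, PiLp.toLp_apply, Matrix.cons_val_zero, Matrix.cons_val_one,
    Int.cast_inj] at h₀ h₁
  rw [h₀, h₁]

theorem dist_gridPoint (p q : ℤ × ℤ) :
    dist (gridPoint p.1 p.2) (gridPoint q.1 q.2) = 1 ↔ latNorm 0 (q - p) = 1 := by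
  rw [EuclideanSpace.dist_eq, Real.sqrt_eq_one, Fin.sum_univ_two, ← Int.cast_inj (α := ℝ)]
  simp only [gridPoint, PiLp.toLp_apply, Matrix.cons_val_zero, Matrix.cons_val_one, Real.dist_eq,
    sq_abs, latNorm, Prod.fst_sub, Prod.snd_sub]
  push_cast
  constructor <;> intro h <;> linarith

theorem triPoint_injective : Function.Injective fun p : ℤ × ℤ => triPoint p.1 p.2 := by
  rintro ⟨a, b⟩ ⟨c, d⟩ h
  have h₀ := congrArg (fun x : Plane => x 0) h
  have h₁ := congrArg (fun x : Plane => x 1) h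
  simp only [triPoint, PiLp.toLp_apply, Matrix.cons_val_zero, Matrix.cons_val_one] at h₀ h₁
  have h₂ : (b : ℝ) = d := mul_right_cancel₀ (by positivity) h₁
  rw [h₂, add_left_inj, Int.cast_inj] at h₀
  rw [Int.cast_inj] at h₂
  rw [h₀, h₂]

theorem dist_triPoint (p q : ℤ × ℤ) :
    dist (triPoint p.1 p.2) (triPoint q.1 q.2) = 1 ↔ latNorm 1 (q - p) = 1 := by
  rw [EuclideanSpace.dist_eq, Real.sqrt_eq_one, Fin.sum_univ_two, ← Int.cast_inj (α := ℝ)]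
  simp only [triPoint, PiLp.toLp_apply, Matrix.cons_val_zero, Matrix.cons_val_one, Real.dist_eq,
    sq_abs, latNorm, Prod.fst_sub, Prod.snd_sub]
  push_cast
  have h3 : (√3 : ℝ) ^ 2 = 3 := Real.sq_sqrt (by norm_num)
  have key : ((p.1 : ℝ) + p.2 / 2 - (q.1 + q.2 / 2)) ^ 2 + (p.2 * (√3 / 2) - q.2 * (√3 / 2)) ^ 2 =
      ((q.1 : ℝ) - p.1) ^ 2 + 1 * (q.1 - p.1) * (q.2 - p.2) + (q.2 - p.2) ^ 2 := by
    linear_combination ((p.2 : ℝ) - q.2) ^ 2 / 4 * h3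
  rw [key]

/-- The lattice points whose image under `φ` lies in `[0, n) × [0, n)`. -/
def latWindow (φ : ℤ → ℤ → Plane) (n : ℕ) : Set (ℤ × ℤ) :=
  {p | ∀ i : Fin 2, φ p.1 p.2 i ∈ Set.Ico (0 : ℝ) n}

/-- Serves all three tilings: `φ` supplies coordinates, and `hd` turns unit distance into norm one.
-/
theorem exists_isLabelling {k : ℕ} {t : ℤ} {K : Set (ℤ × ℤ)} {φ : ℤ → ℤ → Plane}
    (hφ : Function.Injective fun p : ℤ × ℤ => φ p.1 p.2)
    (hd : ∀ p q : ℤ × ℤ, dist (φ p.1 p.2) (φ q.1 q.2) = 1 ↔ latNorm t (q - p) = 1)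
    (hk : ∀ x, x ∈ tilingVertices k ↔ ∃ p ∈ K, x = φ p.1 p.2) (n : ℕ) :
    ∃ e, IsLabelling t K (latWindow φ n) (tiling k n) e := by
  choose g hgK hg using fun x : tilingVertices k => (hk x).1 x.2
  refine ⟨fun v => g v.1, ?_, ?_, ?_⟩
  · intro v w h
    have h' : g v.1 = g w.1 := h
    refine Subtype.ext (Subtype.ext ?_)
    rw [hg v.1, hg w.1, h']
  · intro v w
    rw [latGraph_adj, ← hd, ← hg, ← hg]
    rfl
  · intro p
    constructor
    · rintro ⟨v, rfl⟩
      refine ⟨fun i => ?_, hgK _⟩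
      rw [← hg]
      exact v.2 i
    · rintro ⟨hW, hK⟩
      have hx : φ p.1 p.2 ∈ tilingVertices k := (hk _).2 ⟨p, hK, rfl⟩
      exact ⟨⟨⟨_, hx⟩, hW⟩, hφ (hg ⟨_, hx⟩).symm⟩

theorem exists_isLabelling_three (n : ℕ) :
    ∃ e, IsLabelling 1 Set.univ (latWindow triPoint n) (tiling 3 n) e :=
  exists_isLabelling triPoint_injective dist_triPoint (fun x => by simp [tilingVertices]) n

theorem exists_isLabelling_four (n : ℕ) :
    ∃ e, IsLabelling 0 Set.univ (latWindow gridPoint n) (tiling 4 n) e :=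
  exists_isLabelling gridPoint_injective dist_gridPoint
    (fun x => by simp [tilingVertices, gridPoint]) n

theorem exists_isLabelling_six (n : ℕ) :
    ∃ e, IsLabelling 1 {p | ¬ p.1 - p.2 ≡ -1 [ZMOD 3]} (latWindow triPoint n) (tiling 6 n) e :=
  exists_isLabelling triPoint_injective dist_triPoint (fun x => by simp [tilingVertices]) n

/-! ### Windows of quadratic size with linear boundary -/

theorem tendsto_div_zero_of_le {b w : ℕ → ℕ} (c : ℕ) (hb : ∀ n, b n ≤ c * n)
    (hw : ∀ n, n * n ≤ w n) : Tendsto (fun n => (b n : ℝ) / w n) atTop (𝓝 0) := by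
  refine squeeze_zero (fun n => by positivity) (fun n => ?_)
    (tendsto_const_div_atTop_nhds_zero_nat (c : ℝ))
  rcases Nat.eq_zero_or_pos n with rfl | hn
  · have := hb 0
    simp_all
  · have h₁ : (b n : ℝ) ≤ c * n := by exact_mod_cast hb n
    have h₂ : (n : ℝ) * n ≤ w n := by exact_mod_cast hw n
    have hn' : (0 : ℝ) < n := by exact_mod_cast hn
    calc (b n : ℝ) / w n ≤ (c * n) / (n * n) := by gcongr
      _ = c / n := by field_simp

theorem isFolner_of_le {W : ℕ → Set (ℤ × ℤ)} (hfin : ∀ n, (W n).Finite)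
    (hcard : ∀ n, n * n ≤ (W n).ncard) (c : ℕ)
    (h₁ : ∀ n, {p ∈ W n | p + (1, 0) ∉ W n}.ncard ≤ c * n)
    (h₂ : ∀ n, {p ∈ W n | p + (0, 1) ∉ W n}.ncard ≤ c * n) : IsFolner W := by
  refine isFolner_of_generators hfin ?_ (tendsto_div_zero_of_le c h₁ hcard)
    (tendsto_div_zero_of_le c h₂ hcard)
  filter_upwards [eventually_gt_atTop 0] with n hn
  exact lt_of_lt_of_le (Nat.mul_pos hn hn) (hcard n)

theorem mem_latWindow_gridPoint {n : ℕ} {p : ℤ × ℤ} :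
    p ∈ latWindow gridPoint n ↔ (0 ≤ p.1 ∧ p.1 < n) ∧ 0 ≤ p.2 ∧ p.2 < n := by
  simp only [latWindow, Set.mem_ofPred_eq, Fin.forall_fin_two, gridPoint, PiLp.toLp_apply,
    Matrix.cons_val_zero, Matrix.cons_val_one, Set.mem_Ico]
  norm_cast

theorem mem_latWindow_triPoint {n : ℕ} {p : ℤ × ℤ} :
    p ∈ latWindow triPoint n ↔
      (0 ≤ (p.1 : ℝ) + p.2 / 2 ∧ (p.1 : ℝ) + p.2 / 2 < n) ∧
        0 ≤ (p.2 : ℝ) * (√3 / 2) ∧ (p.2 : ℝ) * (√3 / 2) < n := by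
  simp only [latWindow, Set.mem_ofPred_eq, Fin.forall_fin_two, triPoint, PiLp.toLp_apply,
    Matrix.cons_val_zero, Matrix.cons_val_one, Set.mem_Ico]

theorem latWindow_gridPoint (n : ℕ) :
    latWindow gridPoint n = ((Finset.Ico (0 : ℤ) n ×ˢ Finset.Ico (0 : ℤ) n : Finset (ℤ × ℤ)) :
      Set (ℤ × ℤ)) := by
  ext p
  rw [mem_latWindow_gridPoint]
  simp

theorem ncard_latWindow_gridPoint (n : ℕ) : (latWindow gridPoint n).ncard = n * n := by
  rw [latWindow_gridPoint, Set.ncard_coe_finset]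
  simp

theorem ncard_Ico_int (a : ℤ) (m : ℕ) : (Set.Ico a (a + m)).ncard = m := by
  rw [← Finset.coe_Ico, Set.ncard_coe_finset, Int.card_Ico]
  simp

theorem isFolner_grid : IsFolner (latWindow gridPoint) := by
  refine isFolner_of_le (fun n => ?_) (fun n => (ncard_latWindow_gridPoint n).ge) 1 ?_ ?_
  · rw [latWindow_gridPoint]
    exact Finset.finite_toSet _
  · intro n
    rw [one_mul]
    refine (Set.ncard_le_ncard_of_injOn (t := Set.Ico (0 : ℤ) (0 + n)) Prod.snd ?_ ?_
      (Set.finite_Ico _ _)).trans_eq (ncard_Ico_int 0 n)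
    · rintro ⟨a, b⟩ ⟨h₁, -⟩
      rw [mem_latWindow_gridPoint] at h₁
      simp only [Set.mem_Ico]
      omega
    · rintro ⟨a, b⟩ ⟨h₁, h₂⟩ ⟨c, d⟩ ⟨h₃, h₄⟩ h
      rw [mem_latWindow_gridPoint] at h₁ h₂ h₃ h₄
      simp only [Prod.mk_add_mk, Prod.mk.injEq] at *
      omega
  · intro n
    rw [one_mul]
    refine (Set.ncard_le_ncard_of_injOn (t := Set.Ico (0 : ℤ) (0 + n)) Prod.fst ?_ ?_
      (Set.finite_Ico _ _)).trans_eq (ncard_Ico_int 0 n)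
    · rintro ⟨a, b⟩ ⟨h₁, -⟩
      rw [mem_latWindow_gridPoint] at h₁
      simp only [Set.mem_Ico]
      omega
    · rintro ⟨a, b⟩ ⟨h₁, h₂⟩ ⟨c, d⟩ ⟨h₃, h₄⟩ h
      rw [mem_latWindow_gridPoint] at h₁ h₂ h₃ h₄
      simp only [Prod.mk_add_mk, Prod.mk.injEq] at *
      omega

theorem bounds_of_mem_latWindow_triPoint {n : ℕ} {p : ℤ × ℤ} (h : p ∈ latWindow triPoint n) :
    (-(n : ℤ) ≤ p.1 ∧ p.1 < n) ∧ 0 ≤ p.2 ∧ p.2 < 2 * n := by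
  rw [mem_latWindow_triPoint] at h
  obtain ⟨⟨h₁, h₂⟩, h₃, h₄⟩ := h
  have h3 : 1 < √3 := by rw [Real.lt_sqrt] <;> norm_num
  have hb : (0 : ℝ) ≤ p.2 := nonneg_of_mul_nonneg_left h₃ (by positivity)
  have hb' : (p.2 : ℝ) < 2 * n := by nlinarith
  have e₁ : (-(n : ℤ) : ℝ) ≤ p.1 := by push_cast; linarith
  have e₂ : (p.1 : ℝ) < n := by linarith
  exact ⟨⟨by exact_mod_cast e₁, by exact_mod_cast e₂⟩, by exact_mod_cast hb, by exact_mod_cast hb'⟩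

theorem isFolner_tri : IsFolner (latWindow triPoint) := by
  have h3 : 1 < √3 := by rw [Real.lt_sqrt] <;> norm_num
  have h3' : √3 < 2 := by rw [Real.sqrt_lt] <;> norm_num
  have hfin : ∀ n, (latWindow triPoint n).Finite := fun n =>
    ((Set.finite_Ico (-(n : ℤ)) n).prod (Set.finite_Ico (0 : ℤ) (2 * n))).subset fun p hp => by
      obtain ⟨⟨h₁, h₂⟩, h₃, h₄⟩ := bounds_of_mem_latWindow_triPoint hp
      exact ⟨⟨h₁, h₂⟩, h₃, h₄⟩
  -- Within distance one of the right side there is at most one point per row, and since `√3 > 1`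
  -- there are at most `2 * n` rows.
  have hrow : ∀ (n : ℕ) (S : Set (ℤ × ℤ)), S ⊆ latWindow triPoint n →
      (∀ p ∈ S, (n : ℝ) ≤ p.1 + p.2 / 2 + 1) → S.ncard ≤ 2 * n := by
    intro n S hS hr
    refine (Set.ncard_le_ncard_of_injOn (t := Set.Ico (0 : ℤ) (0 + (2 * n : ℕ))) Prod.snd ?_ ?_
      (Set.finite_Ico _ _)).trans_eq (ncard_Ico_int 0 (2 * n))
    · intro p hp
      have := bounds_of_mem_latWindow_triPoint (hS hp)
      simp only [Set.mem_Ico]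
      omega
    · rintro ⟨a, b⟩ h₁ ⟨c, d⟩ h₂ h
      have e₁ := (mem_latWindow_triPoint.1 (hS h₁)).1.2
      have e₂ := (mem_latWindow_triPoint.1 (hS h₂)).1.2
      have e₃ := hr _ h₁
      have e₄ := hr _ h₂
      simp only at h e₁ e₂ e₃ e₄
      subst h
      have i₁ : (a : ℝ) < c + 1 := by linarith
      have i₂ : (c : ℝ) < a + 1 := by linarith
      norm_cast at i₁ i₂
      rw [Prod.mk.injEq]
      omega
  refine isFolner_of_le hfin (fun n => ?_) 4 (fun n => ?_) (fun n => ?_)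
  · have hc : (((Finset.Ico (0 : ℤ) n ×ˢ Finset.Ico (0 : ℤ) n : Finset (ℤ × ℤ)) :
        Set (ℤ × ℤ))).ncard = n * n := by
      rw [Set.ncard_coe_finset]
      simp
    rw [← hc]
    -- Integer division undoes the shear of the lattice: row `j` starts at abscissa 0 or 1/2. As `√3
    -- < 2`, the rows with `j < n` fit into the window.
    refine Set.ncard_le_ncard_of_injOn (fun p => (p.1 - p.2 / 2, p.2)) ?_ ?_ (hfin n)
    · rintro ⟨i, j⟩ hij
      simp only [Finset.coe_product, Set.mem_prod, Finset.mem_coe, Finset.mem_Ico] at hij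
      obtain ⟨⟨h₁, h₂⟩, h₃, h₄⟩ := hij
      have hj : (2 * (j / 2 : ℤ) : ℝ) ≤ j := by
        have : 2 * (j / 2) ≤ j := by omega
        exact_mod_cast this
      have hj' : (j : ℝ) ≤ 2 * (j / 2 : ℤ) + 1 := by
        have : j ≤ 2 * (j / 2) + 1 := by omega
        exact_mod_cast this
      have h₂' : (i : ℝ) + 1 ≤ n := by exact_mod_cast h₂
      have h₁' : (0 : ℝ) ≤ i := by exact_mod_cast h₁
      have h₃' : (0 : ℝ) ≤ j := by exact_mod_cast h₃
      have h₄' : (j : ℝ) < n := by exact_mod_cast h₄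
      rw [mem_latWindow_triPoint]
      simp only [Int.cast_sub]
      refine ⟨⟨by linarith, by linarith⟩, by positivity, by nlinarith⟩
    · rintro ⟨i, j⟩ - ⟨k, l⟩ - h
      simp only [Prod.mk.injEq] at h ⊢
      omega
  · refine (hrow n _ (Set.sep_subset _ _) ?_).trans (by omega)
    rintro ⟨a, b⟩ ⟨h₁, h₂⟩
    by_contra hcon
    push Not at hcon
    apply h₂
    rw [mem_latWindow_triPoint] at h₁ ⊢
    simp only [Prod.mk_add_mk, Int.cast_add, Int.cast_one, add_zero] at *
    exact ⟨⟨by linarith [h₁.1.1], by linarith⟩, h₁.2⟩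
  · have hsub : {p ∈ latWindow triPoint n | p + (0, 1) ∉ latWindow triPoint n} ⊆
        {p ∈ latWindow triPoint n | (n : ℝ) ≤ p.1 + p.2 / 2 + 1} ∪
        {p ∈ latWindow triPoint n | (n : ℝ) ≤ (p.2 + 1) * (√3 / 2)} := by
      rintro ⟨a, b⟩ ⟨h₁, h₂⟩
      by_contra hcon
      simp only [Set.mem_union, Set.mem_ofPred_eq, not_or, not_and, not_le] at hcon
      have c₁ := hcon.1 h₁
      have c₂ := hcon.2 h₁
      apply h₂
      rw [mem_latWindow_triPoint] at h₁ ⊢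
      simp only [Prod.mk_add_mk, Int.cast_add, Int.cast_one, add_zero] at *
      exact ⟨⟨by linarith [h₁.1.1], by linarith⟩, by nlinarith [h₁.2.1], c₂⟩
    have hr₁ := hrow n {p ∈ latWindow triPoint n | (n : ℝ) ≤ p.1 + p.2 / 2 + 1}
      (Set.sep_subset _ _) (fun p hp => hp.2)
    have hr₂ : {p ∈ latWindow triPoint n | (n : ℝ) ≤ (p.2 + 1) * (√3 / 2)}.ncard ≤ 2 * n := by
      refine (Set.ncard_le_ncard_of_injOn (t := Set.Ico (-n : ℤ) (-n + (2 * n : ℕ))) Prod.fst ?_ ?_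
        (Set.finite_Ico _ _)).trans_eq (ncard_Ico_int _ (2 * n))
      · intro p hp
        have := bounds_of_mem_latWindow_triPoint hp.1
        simp only [Set.mem_Ico]
        omega
      · rintro ⟨a, b⟩ ⟨h₁, e₁⟩ ⟨c, d⟩ ⟨h₂, e₂⟩ h
        have e₃ := (mem_latWindow_triPoint.1 h₁).2.2
        have e₄ := (mem_latWindow_triPoint.1 h₂).2.2
        simp only at h e₁ e₂ e₃ e₄
        have i₁ : (b : ℝ) < d + 1 := lt_of_mul_lt_mul_right (e₃.trans_le e₂) (by positivity)
        have i₂ : (d : ℝ) < b + 1 := lt_of_mul_lt_mul_right (e₄.trans_le e₁) (by positivity)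
        norm_cast at i₁ i₂
        rw [Prod.mk.injEq]
        omega
    refine (Set.ncard_le_ncard hsub ?_).trans ((Set.ncard_union_le _ _).trans (by omega))
    exact ((hfin n).subset (Set.sep_subset _ _)).union ((hfin n).subset (Set.sep_subset _ _))

end ClumsyPacking

namespace ClumsyPacking

/-! ### Square grids in the square grid -/

/-- The units of the square lattice. -/
def gridUnits : Finset (ℤ × ℤ) := {(1, 0), (-1, 0), (0, 1), (0, -1)}

theorem latNorm_zero_eq_one_iff (u : ℤ × ℤ) : latNorm 0 u = 1 ↔ u ∈ gridUnits := by
  constructor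
  · obtain ⟨a, b⟩ := u
    intro h
    simp only [latNorm, zero_mul, add_zero] at h
    have h₁ : -1 ≤ a := by nlinarith
    have h₂ : a ≤ 1 := by nlinarith
    have h₃ : -1 ≤ b := by nlinarith
    have h₄ : b ≤ 1 := by nlinarith
    interval_cases a <;> interval_cases b <;> simp_all [gridUnits]
  · revert u
    decide

/-- Every 4-cycle of the square lattice is a unit square; up to translation this is a finite check
over the units. -/
theorem unit_square {A B C D : ℤ × ℤ} (hAB : (latGraph 0).Adj A B) (hBC : (latGraph 0).Adj B C)
    (hAD : (latGraph 0).Adj A D) (hDC : (latGraph 0).Adj D C) (hAC : A ≠ C) (hBD : B ≠ D) :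
    C - B = D - A ∧ (B - A).1 * (D - A).1 + (B - A).2 * (D - A).2 = 0 := by
  have key : ∀ u ∈ gridUnits, ∀ u' ∈ gridUnits, ∀ v ∈ gridUnits, u ≠ v → u + u' ≠ 0 →
      u + u' - v ∈ gridUnits → u' = v ∧ u.1 * v.1 + u.2 * v.2 = 0 := by decide
  simp only [latGraph_adj, latNorm_zero_eq_one_iff] at hAB hBC hAD hDC
  refine key _ hAB _ hBC _ hAD (fun h => hBD (sub_left_injective h)) (fun h => hAC ?_) ?_
  · rw [sub_add_sub_cancel', sub_eq_zero] at h
    exact h.symm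
  · convert hDC using 1
    abel

/-! ### Rigidity of grids embedded in the square lattice -/

section Rigid

variable {d : ℕ} {f : ℕ → ℕ → ℤ × ℤ}

/-- Conditions on an embedding of the `d × d` grid in the square lattice. -/
structure IsGridMap (d : ℕ) (f : ℕ → ℕ → ℤ × ℤ) : Prop where
  inj : ∀ {i j k l}, i < d → j < d → k < d → l < d → f i j = f k l → i = k ∧ j = l
  horiz : ∀ {i j}, i + 1 < d → j < d → (latGraph 0).Adj (f i j) (f (i + 1) j)
  vert : ∀ {i j}, i < d → j + 1 < d → (latGraph 0).Adj (f i j) (f i (j + 1))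

theorem IsGridMap.swap (hf : IsGridMap d f) : IsGridMap d fun i j => f j i :=
  ⟨fun hi hj hk hl h => (hf.inj hj hi hl hk h).symm, fun hi hj => hf.vert hj hi,
    fun hi hj => hf.horiz hj hi⟩

theorem IsGridMap.square (hf : IsGridMap d f) {i j : ℕ} (hi : i + 1 < d) (hj : j + 1 < d) :
    f (i + 1) (j + 1) - f (i + 1) j = f i (j + 1) - f i j ∧
      (f (i + 1) j - f i j).1 * (f i (j + 1) - f i j).1 +
        (f (i + 1) j - f i j).2 * (f i (j + 1) - f i j).2 = 0 :=
  unit_square (hf.horiz hi (by omega)) (hf.vert hi hj) (hf.vert (by omega) hj)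
    (hf.horiz hi hj)
    (fun h => by have := hf.inj (by omega) (by omega) (by omega) (by omega) h; omega)
    (fun h => by have := hf.inj (by omega) (by omega) (by omega) (by omega) h; omega)

theorem IsGridMap.vert_eq (hf : IsGridMap d f) {i j : ℕ} (hi : i < d) (hj : j + 1 < d) :
    f i (j + 1) - f i j = f 0 (j + 1) - f 0 j := by
  induction i with
  | zero => rfl
  | succ i ih => rw [(hf.square hi hj).1, ih (by omega)]

/-- Consecutive horizontal steps are perpendicular to the same vertical step, hence equal or
opposite, and injectivity rules out turning back. -/
theorem IsGridMap.horiz_zero_eq (hf : IsGridMap d f) {i : ℕ} (hi : i + 1 < d) :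
    f (i + 1) 0 - f i 0 = f 1 0 - f 0 0 := by
  induction i with
  | zero => rfl
  | succ i ih =>
    have key : ∀ h ∈ gridUnits, ∀ h' ∈ gridUnits, ∀ w ∈ gridUnits, h + h' ≠ 0 →
        h.1 * w.1 + h.2 * w.2 = 0 → h'.1 * w.1 + h'.2 * w.2 = 0 → h' = h := by decide
    have s₁ := (hf.square (i := i) (j := 0) (by omega) (by omega)).2
    have s₂ := (hf.square (i := i + 1) (j := 0) hi (by omega)).2
    have hh := hf.horiz (i := i) (j := 0) (by omega) (by omega)
    have hh' := hf.horiz (i := i + 1) (j := 0) hi (by omega)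
    have hw := hf.vert (i := 0) (j := 0) (by omega) (by omega)
    rw [hf.vert_eq (by omega) (by omega)] at s₁ s₂
    rw [latGraph_adj, latNorm_zero_eq_one_iff] at hh hh' hw
    rw [← ih (by omega)]
    refine key _ hh _ hh' _ hw (fun h => ?_) s₁ s₂
    rw [sub_add_sub_cancel', sub_eq_zero] at h
    have := hf.inj hi (by omega) (by omega) (by omega) h
    omega

theorem IsGridMap.eq_affine (hf : IsGridMap d f) {i j : ℕ} (hi : i < d) (hj : j < d) :
    f i j = f 0 0 + i • (f 1 0 - f 0 0) + j • (f 0 1 - f 0 0) := by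
  have h₁ : f i 0 = f 0 0 + i • (f 1 0 - f 0 0) := by
    clear hj
    induction i with
    | zero => simp
    | succ i ih =>
      have h := hf.horiz_zero_eq hi
      rw [sub_eq_iff_eq_add, ih (by omega)] at h
      rw [h, succ_nsmul]
      abel
  induction j with
  | zero => simpa using h₁
  | succ j ih =>
    have h := hf.vert_eq hi hj
    rw [hf.swap.horiz_zero_eq hj, sub_eq_iff_eq_add, ih (by omega)] at h
    rw [h, succ_nsmul]
    abel

theorem IsGridMap.exists_orthonormal (hf : IsGridMap d f) (hd : 2 ≤ d) :
    ∃ u ∈ gridUnits, ∃ w ∈ gridUnits, u.1 * w.1 + u.2 * w.2 = 0 ∧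
      ∀ {i j : ℕ}, i < d → j < d → f i j = f 0 0 + i • u + j • w := by
  refine ⟨_, (latNorm_zero_eq_one_iff _).1 (hf.horiz (i := 0) (j := 0) (by omega) (by omega)),
    _, (latNorm_zero_eq_one_iff _).1 (hf.vert (i := 0) (j := 0) (by omega) (by omega)),
    (hf.square (i := 0) (j := 0) (by omega) (by omega)).2, fun hi hj => hf.eq_affine hi hj⟩

/-- The embedding is an isometry for the norm, so the image has no adjacencies beyond those of the
grid. -/
theorem IsGridMap.latNorm_sub (hf : IsGridMap d f) (hd : 2 ≤ d) {i j k l : ℕ}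
    (hi : i < d) (hj : j < d) (hk : k < d) (hl : l < d) :
    latNorm 0 (f k l - f i j) = latNorm 0 ((k : ℤ) - i, (l : ℤ) - j) := by
  obtain ⟨u, hu, w, hw, huw, h⟩ := hf.exists_orthonormal hd
  rw [h hi hj, h hk hl]
  simp only [gridUnits, Finset.mem_insert, Finset.mem_singleton] at hu hw
  rcases hu with rfl | rfl | rfl | rfl <;> rcases hw with rfl | rfl | rfl | rfl <;>
    simp at huw <;> simp [latNorm] <;> ring

/-- The image of the grid is a block of the square lattice. -/
theorem IsGridMap.exists_range (hf : IsGridMap d f) (hd : 2 ≤ d) :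
    ∃ p : ℤ × ℤ, ∀ q, (∃ i < d, ∃ j < d, f i j = q) ↔
      q - p ∈ Finset.Ico (0 : ℤ) d ×ˢ Finset.Ico (0 : ℤ) d := by
  obtain ⟨u, hu, w, hw, huw, h⟩ := hf.exists_orthonormal hd
  have h' : ∀ q, (∃ i < d, ∃ j < d, f i j = q) ↔
      ∃ i < d, ∃ j < d, f 0 0 + i • u + j • w = q := by
    intro q
    constructor <;> rintro ⟨i, hi, j, hj, rfl⟩
    · exact ⟨i, hi, j, hj, (h hi hj).symm⟩
    · exact ⟨i, hi, j, hj, h hi hj⟩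
  simp only [h']
  generalize f 0 0 = r
  obtain ⟨a, b⟩ := r
  -- Here `p` is the lower left corner of the image, and `I`, `J` invert the affine map. Each of the
  -- eight orthonormal pairs then needs only linear arithmetic.
  have hsolve : ∀ (p : ℤ × ℤ) (I J : ℤ → ℤ → ℤ),
      (∀ i j : ℤ, 0 ≤ i → i < d → 0 ≤ j → j < d →
        (0 ≤ a + i * u.1 + j * w.1 - p.1 ∧ a + i * u.1 + j * w.1 - p.1 < d) ∧
          0 ≤ b + i * u.2 + j * w.2 - p.2 ∧ b + i * u.2 + j * w.2 - p.2 < d) →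
      (∀ x y : ℤ, 0 ≤ x → x < d → 0 ≤ y → y < d →
        ((0 ≤ I x y ∧ I x y < d) ∧ 0 ≤ J x y ∧ J x y < d) ∧
          a + I x y * u.1 + J x y * w.1 = x + p.1 ∧ b + I x y * u.2 + J x y * w.2 = y + p.2) →
      ∃ p : ℤ × ℤ, ∀ q, (∃ i < d, ∃ j < d, (a, b) + i • u + j • w = q) ↔
        q - p ∈ Finset.Ico (0 : ℤ) d ×ˢ Finset.Ico (0 : ℤ) d := by
    intro p I J h₁ h₂
    refine ⟨p, fun q => ⟨?_, fun hq => ?_⟩⟩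
    · rintro ⟨i, hi, j, hj, rfl⟩
      have h := h₁ i j (by omega) (by omega) (by omega) (by omega)
      simpa using h
    · rw [Finset.mem_product, Finset.mem_Ico, Finset.mem_Ico] at hq
      obtain ⟨⟨⟨hi, hi'⟩, hj, hj'⟩, hx, hy⟩ := h₂ _ _ hq.1.1 hq.1.2 hq.2.1 hq.2.2
      simp only [Prod.fst_sub, Prod.snd_sub] at hi hi' hj hj' hx hy
      refine ⟨_, (Int.toNat_lt hi).2 hi', _, (Int.toNat_lt hj).2 hj', ?_⟩
      ext
      · simpa [max_eq_left hi, max_eq_left hj] using hx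
      · simpa [max_eq_left hi, max_eq_left hj] using hy
  simp only [gridUnits, Finset.mem_insert, Finset.mem_singleton] at hu hw
  rcases hu with rfl | rfl | rfl | rfl <;> rcases hw with rfl | rfl | rfl | rfl <;>
    simp at huw
  · exact hsolve (a, b) (fun x y => x) (fun x y => y)
      (by intros; dsimp only; omega) (by intros; dsimp only; omega)
  · exact hsolve (a, b - (d - 1)) (fun x y => x) (fun x y => d - 1 - y)
      (by intros; dsimp only; omega) (by intros; dsimp only; omega)
  · exact hsolve (a - (d - 1), b) (fun x y => d - 1 - x) (fun x y => y)
      (by intros; dsimp only; omega) (by intros; dsimp only; omega)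
  · exact hsolve (a - (d - 1), b - (d - 1)) (fun x y => d - 1 - x) (fun x y => d - 1 - y)
      (by intros; dsimp only; omega) (by intros; dsimp only; omega)
  · exact hsolve (a, b) (fun x y => y) (fun x y => x)
      (by intros; dsimp only; omega) (by intros; dsimp only; omega)
  · exact hsolve (a - (d - 1), b) (fun x y => y) (fun x y => d - 1 - x)
      (by intros; dsimp only; omega) (by intros; dsimp only; omega)
  · exact hsolve (a, b - (d - 1)) (fun x y => d - 1 - y) (fun x y => x)
      (by intros; dsimp only; omega) (by intros; dsimp only; omega)
  · exact hsolve (a - (d - 1), b - (d - 1)) (fun x y => d - 1 - y) (fun x y => d - 1 - x)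
      (by intros; dsimp only; omega) (by intros; dsimp only; omega)

end Rigid

/-- The template of the `d × d` grid. -/
noncomputable def gridTemplate (d : ℕ) (_ : Unit) : Finset (ℤ × ℤ) :=
  Finset.Ico (0 : ℤ) d ×ˢ Finset.Ico (0 : ℤ) d

theorem isPattern_grid (d : ℕ) (hd : 2 ≤ d) :
    IsPattern (tiling 4 d) 0 Set.univ (gridTemplate d) fun _ => Set.univ := by
  obtain ⟨e, he⟩ := exists_isLabelling_four d
  have hrange : ∀ q, (∃ v, e v = q) ↔ q ∈ gridTemplate d () := by
    intro q
    rw [he.range, latWindow_gridPoint]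
    simp [gridTemplate]
  refine ⟨fun _ => ?_, fun _ _ _ _ _ => Set.mem_univ _, fun _ => ⟨e, he.injective, hrange, he.adj⟩,
    ?_⟩
  · simp only [gridTemplate, Finset.mem_product, Finset.mem_Ico, Prod.fst_zero, Prod.snd_zero]
    omega
  · rintro f hf hadj -
    have hex : ∀ i j : ℕ, ∃ v, i < d → j < d → e v = ((i : ℤ), (j : ℤ)) := by
      intro i j
      by_cases h : i < d ∧ j < d
      · obtain ⟨v, hv⟩ := (hrange ((i : ℤ), (j : ℤ))).2 (by simp [gridTemplate, h.1, h.2])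
        exact ⟨v, fun _ _ => hv⟩
      -- A default value that makes `g` total; it is never used for indices within range.
      · obtain ⟨v, -⟩ := (hrange 0).2 (by
          simp only [gridTemplate, Finset.mem_product, Finset.mem_Ico, Prod.fst_zero, Prod.snd_zero]
          omega)
        exact ⟨v, fun h₁ h₂ => absurd ⟨h₁, h₂⟩ h⟩
    choose g hg using hex
    have hsurj : ∀ v, ∃ i < d, ∃ j < d, v = g i j ∧ e v = ((i : ℤ), (j : ℤ)) := by
      intro v
      have hv := (hrange (e v)).1 ⟨v, rfl⟩
      simp only [gridTemplate, Finset.mem_product, Finset.mem_Ico] at hv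
      have hi : (e v).1.toNat < d := by omega
      have hj : (e v).2.toNat < d := by omega
      have hev : e v = (((e v).1.toNat : ℤ), ((e v).2.toNat : ℤ)) := by
        ext
        · exact (Int.toNat_of_nonneg hv.1.1).symm
        · exact (Int.toNat_of_nonneg hv.2.1).symm
      exact ⟨_, hi, _, hj, he.injective (by rw [hg _ _ hi hj]; exact hev), hev⟩
    have hmap : IsGridMap d fun i j => f (g i j) := by
      refine ⟨fun hi hj hk hl h => ?_, fun hi hj => hadj _ _ ?_, fun hi hj => hadj _ _ ?_⟩
      · have h' := congrArg e (hf h)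
        rw [hg _ _ hi hj, hg _ _ hk hl, Prod.mk.injEq] at h'
        exact_mod_cast h'
      · rw [he.adj, hg _ _ (by omega) hj, hg _ _ hi hj]
        simp [latGraph_adj, latNorm]
      · rw [he.adj, hg _ _ hi (by omega), hg _ _ hi hj]
        simp [latGraph_adj, latNorm]
    obtain ⟨p, hp⟩ := hmap.exists_range hd
    refine ⟨(), p, Set.mem_univ _, fun q => ?_, fun x y h => ?_⟩
    · rw [gridTemplate, ← hp]
      constructor
      · rintro ⟨v, rfl⟩
        obtain ⟨i, hi, j, hj, rfl, -⟩ := hsurj v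
        exact ⟨i, hi, j, hj, rfl⟩
      · rintro ⟨i, -, j, -, rfl⟩
        exact ⟨_, rfl⟩
    · obtain ⟨i, hi, j, hj, hx, hex⟩ := hsurj x
      obtain ⟨k, hk, l, hl, hy, hey⟩ := hsurj y
      rw [he.adj, latGraph_adj, hex, hey]
      rw [latGraph_adj, hx, hy, hmap.latNorm_sub hd hi hj hk hl] at h
      exact h

/-- Two blocks meet in a box, which contains an edge unless it is empty or a single point; a single
point occurs exactly at the four corner offsets. -/
theorem conflict_gridTemplate (c : ℕ) (o : ℤ × ℤ) :
    Conflict 0 (gridTemplate (c + 1)) () () o ↔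
      (-(c : ℤ) ≤ o.1 ∧ o.1 ≤ c) ∧ (-(c : ℤ) ≤ o.2 ∧ o.2 ≤ c) ∧
        ¬ ((o.1 = c ∨ o.1 = -c) ∧ (o.2 = c ∨ o.2 = -c)) := by
  obtain ⟨x, y⟩ := o
  simp only [Conflict, gridTemplate, Finset.mem_product, Finset.mem_Ico, Prod.fst_sub, Prod.snd_sub]
  constructor
  · rintro ⟨⟨a₁, a₂⟩, ha, ⟨b₁, b₂⟩, hb, hab, ha', hb'⟩
    have hne : ¬ (a₁ = b₁ ∧ a₂ = b₂) := fun h => hab.ne (Prod.ext h.1 h.2)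
    push_cast at *
    omega
  · rintro ⟨hx, hy, h⟩
    -- The point `(max x 0, max y 0)` is the lower left corner of the intersection. If the
    -- intersection is one column wide, the shared edge has to be vertical.
    by_cases hx' : x = c ∨ x = -c
    · refine ⟨(max x 0, max y 0), ?_, (max x 0, max y 0 + 1), ?_, ?_, ?_, ?_⟩
      case refine_3 => simp [latGraph_adj, latNorm]
      all_goals push_cast; omega
    · refine ⟨(max x 0, max y 0), ?_, (max x 0 + 1, max y 0), ?_, ?_, ?_, ?_⟩
      case refine_3 => simp [latGraph_adj, latNorm]
      all_goals push_cast; omega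

/-- The offsets of the blocks that are in conflict with a given block. -/
noncomputable def gridConflicts (c : ℕ) (_ : Unit) : Finset ((ℤ × ℤ) × Unit) :=
  ((Finset.Icc (-(c : ℤ)) c ×ˢ Finset.Icc (-(c : ℤ)) c) \
    {((c : ℤ), (c : ℤ)), ((c : ℤ), -(c : ℤ)), (-(c : ℤ), (c : ℤ)), (-(c : ℤ), -(c : ℤ))}) ×ˢ
    Finset.univ

theorem card_gridConflicts (c : ℕ) (hc : 1 ≤ c) (s : Unit) :
    (gridConflicts c s).card = (2 * c + 1) ^ 2 - 4 := by
  have hcard : ({((c : ℤ), (c : ℤ)), ((c : ℤ), -(c : ℤ)), (-(c : ℤ), (c : ℤ)),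
      (-(c : ℤ), -(c : ℤ))} : Finset (ℤ × ℤ)).card = 4 := by
    rw [Finset.card_insert_of_notMem, Finset.card_insert_of_notMem, Finset.card_insert_of_notMem,
      Finset.card_singleton] <;>
      simp only [Finset.mem_insert, Finset.mem_singleton, Prod.mk.injEq] <;> omega
  rw [gridConflicts, Finset.card_product, Finset.card_sdiff_of_subset, hcard, Finset.card_product,
    Int.card_Icc]
  · have : ((c : ℤ) + 1 - -c).toNat = 2 * c + 1 := by omega
    rw [this, sq]
    simp
  · intro p
    simp only [Finset.mem_insert, Finset.mem_singleton, Finset.mem_product, Finset.mem_Icc]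
    rintro (rfl | rfl | rfl | rfl) <;> simp only <;> omega

/-- The homomorphism `(a, b) ↦ a + k b` to `ℤ / M`. -/
def linearResidue (M : ℕ) (k : ℤ) : ℤ × ℤ →+ ZMod M where
  toFun p := ((p.1 + k * p.2 : ℤ) : ZMod M)
  map_zero' := by simp
  map_add' p q := by
    simp only [Prod.fst_add, Prod.snd_add]
    push_cast
    ring

theorem linearResidue_apply (M : ℕ) (k : ℤ) (p : ℤ × ℤ) :
    linearResidue M k p = ((p.1 + k * p.2 : ℤ) : ZMod M) := rfl

theorem linearResidue_surjective (M : ℕ) (k : ℤ) : Function.Surjective (linearResidue M k) := by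
  intro r
  obtain ⟨a, rfl⟩ := ZMod.intCast_surjective r
  exact ⟨(a, 0), by simp [linearResidue_apply]⟩

theorem exists_balanced (M c : ℕ) (hM : M = 4 * c ^ 2 + 1) (a : ℤ) :
    ∃ r : ℤ, -(2 * (c : ℤ) ^ 2) ≤ r ∧ r ≤ 2 * (c : ℤ) ^ 2 ∧ (M : ℤ) ∣ r - a := by
  have hM0 : (M : ℤ) = 4 * (c : ℤ) ^ 2 + 1 := by exact_mod_cast hM
  have hMpos : (0 : ℤ) < M := by rw [hM0]; positivity
  refine ⟨(a + 2 * (c : ℤ) ^ 2) % M - 2 * (c : ℤ) ^ 2, ?_, ?_, ?_⟩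
  · have := Int.emod_nonneg (a + 2 * (c : ℤ) ^ 2) (b := (M : ℤ)) hMpos.ne'
    linarith
  · have := Int.emod_lt_of_pos (a + 2 * (c : ℤ) ^ 2) (b := (M : ℤ)) hMpos
    linarith
  · refine ⟨-((a + 2 * (c : ℤ) ^ 2) / M), ?_⟩
    have := Int.emod_add_mul_ediv (a + 2 * (c : ℤ) ^ 2) M
    linarith

theorem exists_bounds_grid (d : ℕ) (hd : 2 ≤ d) :
    ∃ lo hi : ℕ → ℝ,
      Tendsto lo atTop (𝓝 (1 / (4 * (d : ℝ) ^ 2 - 4 * d - 3))) ∧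
      Tendsto hi atTop (𝓝 (1 / (4 * (d : ℝ) ^ 2 - 8 * d + 5))) ∧
      ∀ n, lo n ≤ (cl (tiling 4 n) (tiling 4 d) : ℝ) / (latWindow gridPoint n).ncard ∧
        (cl (tiling 4 n) (tiling 4 d) : ℝ) / (latWindow gridPoint n).ncard ≤ hi n := by
  obtain ⟨c, rfl⟩ : ∃ c, d = c + 1 := ⟨d - 1, by omega⟩
  have hc : 1 ≤ c := by omega
  have hc' : (1 : ℤ) ≤ c := by exact_mod_cast hc
  choose e he using exists_isLabelling_four
  have hne : ∃ a b, (tiling 4 (c + 1)).Adj a b := by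
    obtain ⟨x, hx⟩ := ((he (c + 1)).range (0, 0)).2
      ⟨by
        rw [mem_latWindow_gridPoint]
        refine ⟨⟨?_, ?_⟩, ?_, ?_⟩ <;> push_cast <;> omega, Set.mem_univ _⟩
    obtain ⟨y, hy⟩ := ((he (c + 1)).range (1, 0)).2
      ⟨by
        rw [mem_latWindow_gridPoint]
        refine ⟨⟨?_, ?_⟩, ?_, ?_⟩ <;> push_cast <;> omega, Set.mem_univ _⟩
    exact ⟨x, y, by rw [(he _).adj, hx, hy]; decide⟩
  obtain ⟨M, hM⟩ : ∃ M, M = 4 * c ^ 2 + 1 := ⟨_, rfl⟩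
  have hMpos : NeZero M := ⟨by omega⟩
  have hMZ : (M : ℤ) = 4 * (c : ℤ) ^ 2 + 1 := by exact_mod_cast hM
  let g := linearResidue M (-(2 * c))
  have hD : 4 < (2 * c + 1) ^ 2 := by nlinarith
  obtain ⟨lo, hi, h₁, h₂, h₃⟩ := (isPattern_grid (c + 1) hd).exists_tendsto_bounds hne isFolner_grid
    he (gridConflicts c) ((2 * c + 1) ^ 2 - 4) (by omega) (fun s => (card_gridConflicts c hc s).le)
    (fun s s' o h => by
      rw [conflict_gridTemplate] at h
      simp only [gridConflicts, Finset.mem_product, Finset.mem_sdiff, Finset.mem_insert,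
        Finset.mem_singleton, Finset.mem_Icc, Finset.mem_univ, and_true, Prod.ext_iff]
      omega)
    (fun _ => {p | g p = 0})
    (Finset.Icc (-(c : ℤ)) (2 * c) ×ˢ Finset.Icc (-(c : ℤ)) (2 * c))
    (by
      rintro ⟨⟩ ⟨⟩ p q hp hq h
      refine ⟨rfl, ?_⟩
      rw [conflict_gridTemplate] at h
      obtain ⟨⟨hx, hx'⟩, ⟨hy, hy'⟩, -⟩ := h
      have h0 : g (q - p) = 0 := by
        have hp' : g p = 0 := hp
        have hq' : g q = 0 := hq
        rw [map_sub, hp', hq', sub_zero]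
      rw [linearResidue_apply, ZMod.intCast_zmod_eq_zero_iff_dvd] at h0
      generalize ho : q - p = o at *
      obtain ⟨x, y⟩ := o
      simp only at hx hx' hy hy' h0
      -- Packing: `|x - 2cy| ≤ c + 2c² < M`, so divisibility by `M` forces equality, and then `|x| ≤
      -- c` forces `y = 0`.
      have hz : x + -(2 * (c : ℤ)) * y = 0 := by
        refine Int.eq_zero_of_abs_lt_dvd h0 ?_
        rw [hMZ, abs_lt]
        constructor <;> nlinarith
      have hy0 : y = 0 := by
        by_contra hne
        rcases lt_or_gt_of_ne hne with hlt | hgt <;> nlinarith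
      rw [hy0, mul_zero, add_zero] at hz
      rw [hz, hy0] at ho
      exact (sub_eq_zero.1 ho).symm)
    (by
      rintro ⟨⟩ p -
      obtain ⟨r, hr, hr', hdvd⟩ := exists_balanced M c hM (-(p.1 + -(2 * (c : ℤ)) * p.2))
      -- Domination: division of `r + c` by `2c` writes the balanced residue `r` as `x - 2cy` with
      -- `-c ≤ x < c` and `|y| ≤ c`.
      have hxy : ∃ x y : ℤ, x - 2 * c * y = r ∧ (-(c : ℤ) ≤ x ∧ x ≤ c) ∧ (-(c : ℤ) ≤ y ∧ y ≤ c) ∧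
          ¬ ((x = c ∨ x = -c) ∧ (y = c ∨ y = -c)) := by
        have e₁ := Int.emod_add_mul_ediv (r + c) (2 * c)
        have e₂ := Int.emod_nonneg (r + c) (b := 2 * (c : ℤ)) (by omega)
        have e₃ := Int.emod_lt_of_pos (r + c) (b := 2 * (c : ℤ)) (by omega)
        generalize (r + c) % (2 * (c : ℤ)) = z at *
        generalize (r + c) / (2 * (c : ℤ)) = w at *
        have hw : w ≤ c := by
          by_contra! hcon
          nlinarith
        have hw' : -(c : ℤ) ≤ w := by
          by_contra! hcon
          nlinarith
        have hzw : ¬ (z = 0 ∧ w = -c) := by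
          rintro ⟨rfl, rfl⟩
          nlinarith
        -- The only corner that can arise is `(-c, -c)`, for `r = 2c² - c`; adding `(2c, 1)` leaves
        -- `x - 2cy` unchanged and gives a valid offset.
        by_cases hcor : z = 0 ∧ w = c
        · refine ⟨c, -(w - 1), ?_, by omega, by omega, by omega⟩
          linear_combination e₁ - hcor.1
        · refine ⟨z - c, -w, ?_, by omega, by omega, by omega⟩
          linear_combination e₁
      obtain ⟨x, y, hr₀, hx, hy, hxy⟩ := hxy
      refine ⟨(), p + (x, y), Set.mem_univ _, ?_, ?_, ?_⟩
      · rw [Set.mem_ofPred_eq, linearResidue_apply, ZMod.intCast_zmod_eq_zero_iff_dvd]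
        convert hdvd using 1
        rw [← hr₀]
        simp only [Prod.fst_add, Prod.snd_add]
        ring
      · rw [add_sub_cancel_left, conflict_gridTemplate]
        exact ⟨hx, hy, hxy⟩
      · intro v hv
        simp only [gridTemplate, Finset.mem_product, Finset.mem_Ico, Finset.mem_Icc, Prod.fst_sub,
          Prod.snd_sub, Prod.fst_add, Prod.snd_add] at hv ⊢
        push_cast at hv
        omega)
    (fun _ => isFolner_grid.hasDensity_univ)
    (fun _ => isFolner_grid.hasDensity_residue g (linearResidue_surjective _ _) 0)
  refine ⟨lo, hi, ?_, ?_, h₃⟩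
  · convert h₁ using 2
    rw [Nat.cast_sub hD.le, Fintype.card_unit]
    push_cast
    ring
  · convert h₂ using 2
    rw [hM, Fintype.card_unit]
    push_cast
    ring

theorem tendsto_numEdges_grid :
    Tendsto (fun n => (numEdges (tiling 4 n) : ℝ) / (latWindow gridPoint n).ncard) atTop (𝓝 2) := by
  choose e he using exists_isLabelling_four
  have h := tendsto_numEdges isFolner_grid he gridUnits latNorm_zero_eq_one_iff 1
    (fun u _ => by simpa using isFolner_grid.hasDensity_univ)
  have hc : gridUnits.card = 4 := by decide
  rw [hc] at h
  norm_num at h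
  exact h

theorem numEdges_grid (d : ℕ) (hd : 1 ≤ d) : numEdges (tiling 4 d) = 2 * d * (d - 1) := by
  obtain ⟨e, he⟩ := exists_isLabelling_four d
  obtain ⟨c, rfl⟩ : ∃ c, d = c + 1 := ⟨d - 1, by omega⟩
  have h := he.two_mul_numEdges (isFolner_grid.finite _) gridUnits latNorm_zero_eq_one_iff
  have hbox : ∀ (u : ℤ × ℤ) (a b k l : ℕ),
      (∀ p : ℤ × ℤ, (p ∈ latWindow gridPoint (c + 1) ∧ p + u ∈ latWindow gridPoint (c + 1)) ↔
        ((a : ℤ) ≤ p.1 ∧ p.1 < a + k) ∧ (b : ℤ) ≤ p.2 ∧ p.2 < b + l) →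
      {p ∈ latWindow gridPoint (c + 1) | p ∈ Set.univ ∧ p + u ∈ Set.univ ∧
        p + u ∈ latWindow gridPoint (c + 1)}.ncard = k * l := by
    intro u a b k l hp
    have hset : {p ∈ latWindow gridPoint (c + 1) | p ∈ Set.univ ∧ p + u ∈ Set.univ ∧
        p + u ∈ latWindow gridPoint (c + 1)} = Set.Ico (a : ℤ) (a + k) ×ˢ Set.Ico (b : ℤ) (b + l) := by
      ext p
      simpa using hp p
    rw [hset, Set.ncard_prod, ncard_Ico_int, ncard_Ico_int]
  have n₁ := hbox (1, 0) 0 0 c (c + 1) (fun p => by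
    simp only [mem_latWindow_gridPoint, Prod.fst_add, Prod.snd_add]; push_cast; omega)
  have n₂ := hbox (-1, 0) 1 0 c (c + 1) (fun p => by
    simp only [mem_latWindow_gridPoint, Prod.fst_add, Prod.snd_add]; push_cast; omega)
  have n₃ := hbox (0, 1) 0 0 (c + 1) c (fun p => by
    simp only [mem_latWindow_gridPoint, Prod.fst_add, Prod.snd_add]; push_cast; omega)
  have n₄ := hbox (0, -1) 0 1 (c + 1) c (fun p => by
    simp only [mem_latWindow_gridPoint, Prod.fst_add, Prod.snd_add]; push_cast; omega)
  rw [gridUnits, Finset.sum_insert (by decide), Finset.sum_insert (by decide),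
    Finset.sum_insert (by decide), Finset.sum_singleton, n₁, n₂, n₃, n₄] at h
  rw [Nat.add_sub_cancel]
  linarith

end ClumsyPacking

namespace ClumsyPacking

/-! ### Triangles in the triangular lattice -/

/-- The units of the triangular lattice. -/
def triUnits : Finset (ℤ × ℤ) := {(1, 0), (-1, 0), (0, 1), (0, -1), (1, -1), (-1, 1)}

theorem latNorm_one_eq_one_iff (u : ℤ × ℤ) : latNorm 1 u = 1 ↔ u ∈ triUnits := by
  constructor
  · obtain ⟨a, b⟩ := u
    intro h
    simp only [latNorm, one_mul] at h
    have h₁ : -1 ≤ a := by nlinarith [sq_nonneg (a + 2 * b)]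
    have h₂ : a ≤ 1 := by nlinarith [sq_nonneg (a + 2 * b)]
    have h₃ : -1 ≤ b := by nlinarith [sq_nonneg (2 * a + b)]
    have h₄ : b ≤ 1 := by nlinarith [sq_nonneg (2 * a + b)]
    interval_cases a <;> interval_cases b <;> simp_all [triUnits]
  · revert u
    decide

/-- The templates of the triangles that point upwards (`true`) and downwards (`false`). -/
def triTemplate : Bool → Finset (ℤ × ℤ)
  | true => {(0, 0), (1, 0), (0, 1)}
  | false => {(0, 0), (1, 0), (1, -1)}

theorem isPattern_tri :
    IsPattern (SimpleGraph.cycleGraph 3) 1 Set.univ triTemplate fun _ => Set.univ := by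
  have hadj3 : ∀ a b : Fin 3, (SimpleGraph.cycleGraph 3).Adj a b ↔ a ≠ b := by decide
  refine ⟨by decide, fun _ _ _ _ _ => Set.mem_univ _, ?_, ?_⟩
  · rintro (_ | _)
    · refine ⟨![(0, 0), (1, 0), (1, -1)], by decide, fun q => ?_, by decide⟩
      simp [Fin.exists_fin_succ, triTemplate, eq_comm]
    · refine ⟨![(0, 0), (1, 0), (0, 1)], by decide, fun q => ?_, by decide⟩
      simp [Fin.exists_fin_succ, triTemplate, eq_comm]
  · rintro f hf hadj -
    have key : ∀ u ∈ triUnits, ∀ v ∈ triUnits, v - u ∈ triUnits →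
        ∃ s, ∃ o ∈ ({0, u, v} : Finset (ℤ × ℤ)),
          ({-o, u - o, v - o} : Finset (ℤ × ℤ)) = triTemplate s := by decide
    have h₁ := hadj 0 1 (by decide)
    have h₂ := hadj 0 2 (by decide)
    have h₃ := hadj 1 2 (by decide)
    rw [latGraph_adj, latNorm_one_eq_one_iff] at h₁ h₂ h₃
    obtain ⟨s, o, -, ho⟩ := key _ h₁ _ h₂ (by simpa using h₃)
    refine ⟨s, f 0 + o, Set.mem_univ _, fun q => ?_, fun a b h => ?_⟩
    · rw [← ho]
      simp only [Fin.exists_fin_succ, Finset.mem_insert, Finset.mem_singleton]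
      have e₀ : q - (f 0 + o) = -o ↔ f 0 = q := by
        rw [sub_eq_iff_eq_add, eq_comm, neg_add_eq_sub, add_sub_cancel_right]
      have e₁ : ∀ x, q - (f 0 + o) = x - f 0 - o ↔ x = q := fun x => by
        rw [sub_sub, sub_left_inj, eq_comm]
      rw [e₀, e₁, e₁]
      simp
    · rw [hadj3]
      rintro rfl
      exact h.ne rfl

/-- Leaves finitely many offsets, so that the conflict lists for triangles and hexagons can be
checked by `decide`. -/
theorem exists_conflict_offset {σ : Type*} {t : ℤ} {F : σ → Finset (ℤ × ℤ)} {s s' : σ} {o : ℤ × ℤ}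
    (h : Conflict t F s s' o) : ∃ a ∈ F s, ∃ b ∈ F s', o = a - b := by
  obtain ⟨a, ha, -, -, -, ha', -⟩ := h
  exact ⟨a, ha, a - o, ha', by abel⟩

theorem linearResidue_eq_intCast_iff {M : ℕ} {k r : ℤ} {p : ℤ × ℤ} :
    linearResidue M k p = (r : ZMod M) ↔ (p.1 + k * p.2) % M = r % M := by
  rw [linearResidue_apply, ZMod.intCast_eq_intCast_iff']

theorem IsFolner.hasDensity_emod {W : ℕ → Set (ℤ × ℤ)} (hW : IsFolner W) (M : ℕ) [NeZero M]
    (k r : ℤ) : HasDensity W {p | (p.1 + k * p.2) % M = r % M} (1 / M) := by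
  convert hW.hasDensity_residue (linearResidue M k) (linearResidue_surjective M k) (r : ZMod M)
    using 1
  ext p
  exact linearResidue_eq_intCast_iff.symm

/-- The offsets of the triangles that share an edge with a given triangle. -/
def triConflicts : Bool → Finset ((ℤ × ℤ) × Bool)
  | true => {((0, 0), true), ((0, 0), false), ((0, -1), false), ((1, -1), false)}
  | false => {((0, 0), false), ((0, 0), true), ((0, 1), true), ((-1, 1), true)}

theorem mem_triConflicts {s s' : Bool} {o : ℤ × ℤ} (h : Conflict 1 triTemplate s s' o) :
    (o, s) ∈ triConflicts s' := by
  obtain ⟨a, ha, b, hb, rfl⟩ := exists_conflict_offset h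
  revert s s' a b
  decide

/-- A perfect code of triangles. -/
def triCode (s : Bool) : Set (ℤ × ℤ) := {p | (p.1 + 2 * p.2) % 4 = if s then 0 else 3}

/-- A triangle conflicts with itself and its three neighbours. The upward code triangles have
residue 0 and their downward neighbours have residues 0, 1, 2; the missing residue 3 is that of the
downward code triangles, whose upward neighbours have residues 1, 2, 3. So each triangle is
dominated exactly once. -/
theorem exists_bounds_tri :
    ∃ lo hi : ℕ → ℝ, Tendsto lo atTop (𝓝 (1 / 2)) ∧ Tendsto hi atTop (𝓝 (1 / 2)) ∧
      ∀ n, lo n ≤ (cl (tiling 3 n) (SimpleGraph.cycleGraph 3) : ℝ) / (latWindow triPoint n).ncard ∧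
        (cl (tiling 3 n) (SimpleGraph.cycleGraph 3) : ℝ) / (latWindow triPoint n).ncard ≤ hi n := by
  choose e he using exists_isLabelling_three
  obtain ⟨lo, hi, h₁, h₂, h₃⟩ := isPattern_tri.exists_tendsto_bounds ⟨0, 1, by decide⟩ isFolner_tri
    he triConflicts 4 (by norm_num) (by decide) (fun s s' o h => mem_triConflicts h) triCode
    (Finset.Icc (-2 : ℤ) 2 ×ˢ Finset.Icc (-2 : ℤ) 2)
    (by
      intro s s' p q hp hq h
      have hm := mem_triConflicts h
      generalize ho : q - p = o at *
      obtain rfl : q = p + o := by rw [← ho]; abel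
      obtain ⟨x, y⟩ := o
      rw [triCode, Set.mem_ofPred_eq] at hp hq
      cases s <;> cases s' <;>
        simp only [triConflicts, Finset.mem_insert, Finset.mem_singleton, Prod.mk.injEq, and_true,
          and_false, or_false, false_or, Bool.false_eq_true, reduceCtorEq, if_true, if_false,
          Prod.fst_add, Prod.snd_add] at hm hp hq ⊢
      · simp [hm]
      · omega
      · omega
      · simp [hm])
    (by
      intro s p _
      have key : ∀ s : Bool, ∀ r ∈ ({0, 1, 2, 3} : Finset ℤ), ∃ s' : Bool,
          ∃ o ∈ ({(0, 0), (0, -1), (1, -1), (0, 1), (-1, 1)} : Finset (ℤ × ℤ)),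
            (r + (o.1 + 2 * o.2)) % 4 = (if s' then 0 else 3) ∧ Conflict 1 triTemplate s s' o ∧
            ∀ v ∈ triTemplate s', (-2 ≤ (o + v).1 ∧ (o + v).1 ≤ 2) ∧
              -2 ≤ (o + v).2 ∧ (o + v).2 ≤ 2 := by
        decide
      obtain ⟨s', o, -, hr, hconf, hv⟩ := key s ((p.1 + 2 * p.2) % 4) (by
        simp only [Finset.mem_insert, Finset.mem_singleton]; omega)
      refine ⟨s', p + o, Set.mem_univ _, ?_, by rwa [add_sub_cancel_left], fun v hv' => ?_⟩
      · rw [triCode, Set.mem_ofPred_eq, Prod.fst_add, Prod.snd_add, ← hr]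
        omega
      · rw [add_assoc, add_sub_cancel_left, Finset.mem_product, Finset.mem_Icc, Finset.mem_Icc]
        exact hv v hv')
    (fun _ => isFolner_tri.hasDensity_univ)
    (fun s => by
      have h := isFolner_tri.hasDensity_emod 4 2 (if s then 0 else 3)
      cases s <;> exact h)
  refine ⟨lo, hi, ?_, ?_, h₃⟩
  · convert h₁ using 2
    norm_num
  · convert h₂ using 2
    norm_num

theorem tendsto_numEdges_tri :
    Tendsto (fun n => (numEdges (tiling 3 n) : ℝ) / (latWindow triPoint n).ncard) atTop (𝓝 3) := by
  choose e he using exists_isLabelling_three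
  have h := tendsto_numEdges isFolner_tri he triUnits latNorm_one_eq_one_iff 1
    (fun u _ => by simpa using isFolner_tri.hasDensity_univ)
  have hc : triUnits.card = 6 := by decide
  rw [hc] at h
  norm_num at h
  exact h

/-! ### Hexagons in the hexagonal lattice -/

/-- The template of the hexagons, based at the vertex to the left of the centre. -/
def hexTemplate (_ : Unit) : Finset (ℤ × ℤ) := {(2, 0), (1, 1), (0, 1), (0, 0), (1, -1), (2, -1)}

/-- The positions of the hexagons. -/
def hexPositions (_ : Unit) : Set (ℤ × ℤ) := {p | (p.1 - p.2) % 3 = 1}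

/-- The steps from the vertices of the hexagonal lattice in `hexPositions`. -/
def hexSteps : Finset (ℤ × ℤ) := {(-1, 0), (0, 1), (1, -1)}

/-- The hexagonal lattice is bipartite, with `p.1 - p.2` modulo 3 equal to 1 or 0 on the two sides,
and `hexSteps` lists the three steps from the first side. -/
theorem hex_step {p q : ℤ × ℤ} (hp : (p.1 - p.2) % 3 = 1) (hq : ¬ (q.1 - q.2) % 3 = 2)
    (h : (latGraph 1).Adj p q) : q - p ∈ hexSteps ∧ (q.1 - q.2) % 3 = 0 := by
  rw [latGraph_adj, latNorm_one_eq_one_iff] at h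
  generalize ho : q - p = o at *
  obtain rfl : q = p + o := by rw [← ho]; abel
  simp only [Prod.fst_add, Prod.snd_add] at *
  simp only [triUnits, Finset.mem_insert, Finset.mem_singleton] at h
  rcases h with rfl | rfl | rfl | rfl | rfl | rfl <;> first
    | exact ⟨by decide, by simp only; omega⟩
    | (simp only at hq; omega)

theorem hex_step' {p q : ℤ × ℤ} (hp : (p.1 - p.2) % 3 = 0) (hq : ¬ (q.1 - q.2) % 3 = 2)
    (h : (latGraph 1).Adj p q) : p - q ∈ hexSteps ∧ (q.1 - q.2) % 3 = 1 := by
  have hq1 : (q.1 - q.2) % 3 = 1 := by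
    rw [latGraph_adj, latNorm_one_eq_one_iff] at h
    generalize ho : q - p = o at *
    obtain rfl : q = p + o := by rw [← ho]; abel
    simp only [Prod.fst_add, Prod.snd_add] at *
    simp only [triUnits, Finset.mem_insert, Finset.mem_singleton] at h
    rcases h with rfl | rfl | rfl | rfl | rfl | rfl <;> simp only at hq ⊢ <;> omega
  exact ⟨(hex_step hq1 (by omega) h.symm).1, hq1⟩

/-- The closed path of length six from the origin with the given steps, up to the sign `ε`. -/
def hexPath (ε : ℤ) (u₀ v₁ u₂ v₃ u₄ : ℤ × ℤ) : Fin 6 → ℤ × ℤ :=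
  ![0, ε • u₀, ε • (u₀ - v₁), ε • (u₀ - v₁ + u₂), ε • (u₀ - v₁ + u₂ - v₃),
    ε • (u₀ - v₁ + u₂ - v₃ + u₄)]

-- A 6-cycle alternates between the two sides, and injectivity forbids immediate reversals, so
-- finitely many step sequences remain. Each closed one bounds a hexagon; `o` selects the vertex to
-- the left of the centre.
set_option maxRecDepth 10000 in
set_option maxHeartbeats 1000000 in
theorem hexPath_closed : ∀ ε ∈ ({1, -1} : Finset ℤ), ∀ u₀ ∈ hexSteps, ∀ v₁ ∈ hexSteps, u₀ ≠ v₁ →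
    ∀ u₂ ∈ hexSteps, v₁ ≠ u₂ → ∀ v₃ ∈ hexSteps, u₂ ≠ v₃ → ∀ u₄ ∈ hexSteps, v₃ ≠ u₄ →
    u₀ - v₁ + u₂ - v₃ + u₄ ∈ hexSteps →
    (∃ o : Fin 6, (((hexPath ε u₀ v₁ u₂ v₃ u₄ o).1 - (hexPath ε u₀ v₁ u₂ v₃ u₄ o).2) % 3 =
        if ε = 1 then 0 else 1) ∧
      (Finset.univ.image fun a => hexPath ε u₀ v₁ u₂ v₃ u₄ a - hexPath ε u₀ v₁ u₂ v₃ u₄ o) =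
        hexTemplate ()) ∧
    ∀ a b, (latGraph 1).Adj (hexPath ε u₀ v₁ u₂ v₃ u₄ a) (hexPath ε u₀ v₁ u₂ v₃ u₄ b) →
      (SimpleGraph.cycleGraph 6).Adj a b := by
  decide

theorem mem_hexVertices {p : ℤ × ℤ} :
    p ∈ {p : ℤ × ℤ | ¬ p.1 - p.2 ≡ -1 [ZMOD 3]} ↔ ¬ (p.1 - p.2) % 3 = 2 := by
  simp [Int.ModEq]

theorem isPattern_hex :
    IsPattern (SimpleGraph.cycleGraph 6) 1 {p | ¬ p.1 - p.2 ≡ -1 [ZMOD 3]} hexTemplate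
      hexPositions := by
  refine ⟨by decide, fun _ p hp v hv => ?_, fun _ => ?_, fun f hf hadj hK => ?_⟩
  · rw [mem_hexVertices]
    rw [hexPositions, Set.mem_ofPred_eq] at hp
    simp only [hexTemplate, Finset.mem_insert, Finset.mem_singleton] at hv
    rcases hv with rfl | rfl | rfl | rfl | rfl | rfl <;>
      simp only [Prod.fst_add, Prod.snd_add] <;> omega
  · refine ⟨![(2, 0), (1, 1), (0, 1), (0, 0), (1, -1), (2, -1)], by decide, fun q => ?_, by decide⟩
    simp [Fin.exists_fin_succ, hexTemplate, eq_comm]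
  · simp only [mem_hexVertices] at hK
    -- The sign `ε` treats both possible sides of `f 0` at once, since steps from the other side are
    -- negatives of `hexSteps`.
    have finish : ∀ ε ∈ ({1, -1} : Finset ℤ),
        ((f 0).1 - (f 0).2) % 3 = (if ε = 1 then 1 else 0) →
        ε • (f 1 - f 0) ∈ hexSteps → ε • (f 1 - f 2) ∈ hexSteps →
        ε • (f 3 - f 2) ∈ hexSteps → ε • (f 3 - f 4) ∈ hexSteps →
        ε • (f 5 - f 4) ∈ hexSteps → ε • (f 5 - f 0) ∈ hexSteps →
        ∃ s, ∃ p ∈ hexPositions s, (∀ q, (∃ a, f a = q) ↔ q - p ∈ hexTemplate s) ∧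
          ∀ a b, (latGraph 1).Adj (f a) (f b) → (SimpleGraph.cycleGraph 6).Adj a b := by
      intro ε hε h0 h₁ h₂ h₃ h₄ h₅ h₆
      have hεε : ε * ε = 1 := by
        simp only [Finset.mem_insert, Finset.mem_singleton] at hε
        rcases hε with rfl | rfl <;> norm_num
      have hinj : ∀ {x y : ℤ × ℤ}, ε • x = ε • y → x = y := fun {x y} h => by
        have h' := congrArg (ε • ·) h
        simpa only [smul_smul, hεε, one_smul] using h'
      have hne : ∀ {i j : Fin 6}, f i = f j → i = j := fun h => hf h
      obtain ⟨⟨o, ho, himg⟩, hch⟩ := hexPath_closed ε hε _ h₁ _ h₂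
        (fun h => absurd (hne (sub_right_injective (hinj h))) (by decide)) _ h₃
        (fun h => absurd (hne (sub_left_injective (hinj h))) (by decide)) _ h₄
        (fun h => absurd (hne (sub_right_injective (hinj h))) (by decide)) _ h₅
        (fun h => absurd (hne (sub_left_injective (hinj h))) (by decide))
        (by
          rw [← smul_sub, ← smul_add, ← smul_sub, ← smul_add]
          convert h₆ using 2
          abel)
      set x := hexPath ε (ε • (f 1 - f 0)) (ε • (f 1 - f 2)) (ε • (f 3 - f 2)) (ε • (f 3 - f 4))
        (ε • (f 5 - f 4)) with hx
      have hfx : ∀ a, f a = x a + f 0 := by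
        intro a
        have hεε' : (ε : ℤ × ℤ) * ε = 1 := by exact_mod_cast congrArg (Int.cast : ℤ → ℤ × ℤ) hεε
        rw [hx]
        fin_cases a <;> simp [hexPath]
        · linear_combination (f 0 - f 1) * hεε'
        · linear_combination (f 0 - f 2) * hεε'
        · linear_combination (f 0 - f 3) * hεε'
        · linear_combination (f 0 - f 4) * hεε'
        · linear_combination (f 0 - f 5) * hεε'
      refine ⟨(), x o + f 0, ?_, fun q => ?_, fun a b h => hch a b ?_⟩
      · rw [hexPositions, Set.mem_ofPred_eq, Prod.fst_add, Prod.snd_add]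
        split_ifs at h0 ho <;> omega
      · rw [← himg, Finset.mem_image]
        refine exists_congr fun a => ?_
        rw [hfx a]
        constructor
        · rintro rfl
          exact ⟨Finset.mem_univ _, by abel⟩
        · rintro ⟨-, h⟩
          rw [eq_sub_iff_add_eq] at h
          rw [← h]
          abel
      · rwa [hfx a, hfx b, latGraph_adj_add] at h
    have a₁ := hadj 0 1 (by decide)
    have a₂ := hadj 1 2 (by decide)
    have a₃ := hadj 2 3 (by decide)
    have a₄ := hadj 3 4 (by decide)
    have a₅ := hadj 4 5 (by decide)
    have a₆ := hadj 0 5 (by decide)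
    by_cases h0 : ((f 0).1 - (f 0).2) % 3 = 1
    · obtain ⟨s₁, c₁⟩ := hex_step h0 (hK 1) a₁
      obtain ⟨s₂, c₂⟩ := hex_step' c₁ (hK 2) a₂
      obtain ⟨s₃, c₃⟩ := hex_step c₂ (hK 3) a₃
      obtain ⟨s₄, c₄⟩ := hex_step' c₃ (hK 4) a₄
      obtain ⟨s₅, -⟩ := hex_step c₄ (hK 5) a₅
      obtain ⟨s₆, -⟩ := hex_step h0 (hK 5) a₆
      exact finish 1 (by decide) h0 (by simpa using s₁) (by simpa using s₂) (by simpa using s₃)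
        (by simpa using s₄) (by simpa using s₅) (by simpa using s₆)
    · have h0' : ((f 0).1 - (f 0).2) % 3 = 0 := by
        have := hK 0
        omega
      obtain ⟨s₁, c₁⟩ := hex_step' h0' (hK 1) a₁
      obtain ⟨s₂, c₂⟩ := hex_step c₁ (hK 2) a₂
      obtain ⟨s₃, c₃⟩ := hex_step' c₂ (hK 3) a₃
      obtain ⟨s₄, c₄⟩ := hex_step c₃ (hK 4) a₄
      obtain ⟨s₅, -⟩ := hex_step' c₄ (hK 5) a₅
      obtain ⟨s₆, -⟩ := hex_step' h0' (hK 5) a₆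
      exact finish (-1) (by decide) (by simpa using h0') (by simpa using s₁) (by simpa using s₂) (by simpa using s₃)
        (by simpa using s₄) (by simpa using s₅) (by simpa using s₆)

/-- The offsets of the hexagons that share an edge with a given hexagon. -/
def hexConflicts (_ : Unit) : Finset ((ℤ × ℤ) × Unit) :=
  {((0, 0), ()), ((1, 1), ()), ((-1, -1), ()), ((2, -1), ()), ((-2, 1), ()), ((1, -2), ()),
    ((-1, 2), ())}

theorem mem_hexConflicts {s s' : Unit} {o : ℤ × ℤ} (h : Conflict 1 hexTemplate s s' o) :
    (o, s) ∈ hexConflicts s' := by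
  obtain ⟨a, ha, b, hb, rfl⟩ := exists_conflict_offset h
  revert s s' a b
  decide

/-- A perfect code of hexagons. -/
def hexCode (_ : Unit) : Set (ℤ × ℤ) := {p | (p.1 + 17 * p.2) % 21 = 1}

theorem hasDensity_hexPositions (s : Unit) :
    HasDensity (latWindow triPoint) (hexPositions s) (1 / 3) := by
  have h := isFolner_tri.hasDensity_emod 3 (-1) 1
  rw [Nat.cast_ofNat (R := ℝ)] at h
  convert h using 1
  ext p
  simp only [hexPositions, Set.mem_ofPred_eq]
  norm_num [← sub_eq_add_neg]

/-- The seven conflict offsets take the values 0, 3, ..., 18 of `x + 17 * y` modulo 21, each once,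
and on hexagon positions this residue is 1 modulo 3. So every hexagon is dominated by exactly one
code hexagon. -/
theorem exists_bounds_hex :
    ∃ lo hi : ℕ → ℝ, Tendsto lo atTop (𝓝 (1 / 21)) ∧ Tendsto hi atTop (𝓝 (1 / 21)) ∧
      ∀ n, lo n ≤ (cl (tiling 6 n) (SimpleGraph.cycleGraph 6) : ℝ) / (latWindow triPoint n).ncard ∧
        (cl (tiling 6 n) (SimpleGraph.cycleGraph 6) : ℝ) / (latWindow triPoint n).ncard ≤ hi n := by
  choose e he using exists_isLabelling_six
  obtain ⟨lo, hi, h₁, h₂, h₃⟩ := isPattern_hex.exists_tendsto_bounds ⟨0, 1, by decide⟩ isFolner_tri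
    he hexConflicts 7 (by norm_num) (by decide) (fun s s' o h => mem_hexConflicts h) hexCode
    (Finset.Icc (-4 : ℤ) 4 ×ˢ Finset.Icc (-4 : ℤ) 4)
    (by
      intro s s' p q hp hq h
      have hm := mem_hexConflicts h
      generalize ho : q - p = o at *
      obtain rfl : q = p + o := by rw [← ho]; abel
      obtain ⟨x, y⟩ := o
      rw [hexCode, Set.mem_ofPred_eq] at hp hq
      simp only [hexConflicts, Finset.mem_insert, Finset.mem_singleton, Prod.mk.injEq, and_true,
        Prod.fst_add, Prod.snd_add] at hm hq
      have hxy : x = 0 ∧ y = 0 := by omega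
      exact ⟨rfl, by simp [hxy.1, hxy.2]⟩)
    (by
      intro s p hp
      have key : ∀ r ∈ ({1, 4, 7, 10, 13, 16, 19} : Finset ℤ),
          ∃ o ∈ ({(0, 0), (1, 1), (-1, -1), (2, -1), (-2, 1), (1, -2), (-1, 2)} :
            Finset (ℤ × ℤ)),
            (r + (o.1 + 17 * o.2)) % 21 = 1 ∧ Conflict 1 hexTemplate () () o ∧
            ∀ v ∈ hexTemplate (), (-4 ≤ (o + v).1 ∧ (o + v).1 ≤ 4) ∧
              -4 ≤ (o + v).2 ∧ (o + v).2 ≤ 4 := by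
        decide
      rw [hexPositions, Set.mem_ofPred_eq] at hp
      obtain ⟨o, -, hr, hconf, hv⟩ := key ((p.1 + 17 * p.2) % 21) (by
        simp only [Finset.mem_insert, Finset.mem_singleton]; omega)
      have hcode : p + o ∈ hexCode () := by
        rw [hexCode, Set.mem_ofPred_eq, Prod.fst_add, Prod.snd_add]
        omega
      refine ⟨(), p + o, ?_, hcode, by rwa [add_sub_cancel_left], fun v hv' => ?_⟩
      · rw [hexCode, Set.mem_ofPred_eq] at hcode
        rw [hexPositions, Set.mem_ofPred_eq]
        omega
      · rw [add_assoc, add_sub_cancel_left, Finset.mem_product, Finset.mem_Icc, Finset.mem_Icc]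
        exact hv v hv')
    hasDensity_hexPositions
    (fun _ => isFolner_tri.hasDensity_emod 21 17 1)
  refine ⟨lo, hi, ?_, ?_, h₃⟩
  · convert h₁ using 2
    norm_num
  · convert h₂ using 2
    norm_num

theorem tendsto_numEdges_hex :
    Tendsto (fun n => (numEdges (tiling 6 n) : ℝ) / (latWindow triPoint n).ncard) atTop (𝓝 1) := by
  choose e he using exists_isLabelling_six
  have h := tendsto_numEdges isFolner_tri he triUnits latNorm_one_eq_one_iff (1 / 3)
    (fun u hu => by
      have hden : ∀ r : ℤ, HasDensity (latWindow triPoint) {p | (p.1 - p.2) % 3 = r % 3} (1 / 3) :=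
        fun r => by
          have h := isFolner_tri.hasDensity_emod 3 (-1) r
          rw [Nat.cast_ofNat (R := ℝ)] at h
          convert h using 1
          ext p
          norm_num [← sub_eq_add_neg]
      have hset : ∃ r : ℤ, {p : ℤ × ℤ | p ∈ {p : ℤ × ℤ | ¬ p.1 - p.2 ≡ -1 [ZMOD 3]} ∧
          p + u ∈ {p : ℤ × ℤ | ¬ p.1 - p.2 ≡ -1 [ZMOD 3]}} = {p | (p.1 - p.2) % 3 = r % 3} := by
        -- A unit changes the class modulo 3 by 1 or 2; both ends avoid class 2 only when starting
        -- from class 0 or 1 respectively.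
        refine ⟨(u.1 - u.2) % 3 - 1, ?_⟩
        ext p
        rw [Set.mem_ofPred_eq, mem_hexVertices, mem_hexVertices]
        simp only [triUnits, Finset.mem_insert, Finset.mem_singleton] at hu
        rcases hu with rfl | rfl | rfl | rfl | rfl | rfl <;>
          simp only [Prod.fst_add, Prod.snd_add, Set.mem_ofPred_eq] <;> omega
      obtain ⟨r, hr⟩ := hset
      rw [hr]
      exact hden r)
  have hc : triUnits.card = 6 := by decide
  rw [hc] at h
  norm_num at h
  exact h

end ClumsyPacking

namespace ClumsyPacking

/-! ### The asymptotic values -/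

theorem tendsto_of_bounds {x lo hi : ℕ → ℝ} {a : ℝ} (h₁ : Tendsto lo atTop (𝓝 a))
    (h₂ : Tendsto hi atTop (𝓝 a)) (h₃ : ∀ n, lo n ≤ x n ∧ x n ≤ hi n) : Tendsto x atTop (𝓝 a) :=
  tendsto_of_tendsto_of_tendsto_of_le_of_le h₁ h₂ (fun n => (h₃ n).1) (fun n => (h₃ n).2)

theorem tendsto_mul_div {W : ℕ → Set (ℤ × ℤ)} (hW : IsFolner W) {x y : ℕ → ℝ} {a b : ℝ}
    (k : ℝ) (hx : Tendsto (fun n => x n / (W n).ncard) atTop (𝓝 a))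
    (hy : Tendsto (fun n => y n / (W n).ncard) atTop (𝓝 b)) (hb : b ≠ 0) :
    Tendsto (fun n => k * x n / y n) atTop (𝓝 (k * a / b)) := by
  refine ((hx.const_mul k).div hy hb).congr' ?_
  filter_upwards [hW.pos] with n hn
  have hn' : ((W n).ncard : ℝ) ≠ 0 := by positivity
  rw [Pi.div_apply, mul_div_assoc', div_div_div_cancel_right₀ hn']

/-- Makes the square case an instance of the block bounds with `d = 2`. -/
theorem nonempty_cycleGraph_four_iso : Nonempty (SimpleGraph.cycleGraph 4 ≃g tiling 4 2) := by
  obtain ⟨e, he⟩ := exists_isLabelling_four 2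
  let x : Fin 4 → ℤ × ℤ := ![(0, 0), (1, 0), (1, 1), (0, 1)]
  have hx : ∀ a, ∃ v, e v = x a := fun a => by
    rw [he.range, mem_latWindow_gridPoint]
    refine ⟨?_, Set.mem_univ _⟩
    revert a
    decide
  have hxinj : Function.Injective x := by decide
  have hxadj : ∀ a b, (SimpleGraph.cycleGraph 4).Adj a b ↔ (latGraph 0).Adj (x a) (x b) := by decide
  choose g hg using hx
  refine ⟨⟨Equiv.ofBijective g ⟨fun a b h => hxinj ?_, fun v => ?_⟩, fun {a b} => ?_⟩⟩
  · rw [← hg, ← hg, h]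
  · have hv := ((he.range _).1 ⟨v, rfl⟩).1
    rw [mem_latWindow_gridPoint] at hv
    have hmem : e v = (0, 0) ∨ e v = (1, 0) ∨ e v = (1, 1) ∨ e v = (0, 1) := by
      simp only [Prod.ext_iff]
      omega
    rcases hmem with h | h | h | h
    · exact ⟨0, he.injective ((hg 0).trans h.symm)⟩
    · exact ⟨1, he.injective ((hg 1).trans h.symm)⟩
    · exact ⟨2, he.injective ((hg 2).trans h.symm)⟩
    · exact ⟨3, he.injective ((hg 3).trans h.symm)⟩
  · change (tiling 4 2).Adj (g a) (g b) ↔ _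
    rw [he.adj, hg, hg, hxadj]

theorem tendsto_cl_three :
    Tendsto (fun n => (cl (tiling 3 n) (SimpleGraph.cycleGraph 3) : ℝ) /
      (latWindow triPoint n).ncard) atTop (𝓝 (1 / 2)) := by
  obtain ⟨lo, hi, h₁, h₂, h₃⟩ := exists_bounds_tri
  exact tendsto_of_bounds h₁ h₂ h₃

theorem tendsto_cl_four :
    Tendsto (fun n => (cl (tiling 4 n) (SimpleGraph.cycleGraph 4) : ℝ) /
      (latWindow gridPoint n).ncard) atTop (𝓝 (1 / 5)) := by
  obtain ⟨lo, hi, h₁, h₂, h₃⟩ := exists_bounds_grid 2 le_rfl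
  obtain ⟨φ⟩ := nonempty_cycleGraph_four_iso
  simp only [cl_congr _ φ]
  norm_num at h₁ h₂
  norm_num
  exact tendsto_of_bounds h₁ h₂ h₃

theorem tendsto_cl_six :
    Tendsto (fun n => (cl (tiling 6 n) (SimpleGraph.cycleGraph 6) : ℝ) /
      (latWindow triPoint n).ncard) atTop (𝓝 (1 / 21)) := by
  obtain ⟨lo, hi, h₁, h₂, h₃⟩ := exists_bounds_hex
  exact tendsto_of_bounds h₁ h₂ h₃

theorem isEquivalent_cl_four :
    (fun n : ℕ => (cl (tiling 4 n) (SimpleGraph.cycleGraph 4) : ℝ)) ~[atTop]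
      fun n : ℕ => (n : ℝ) ^ 2 / 5 := by
  rw [isEquivalent_iff_tendsto_one]
  · have h := tendsto_cl_four.const_mul 5
    norm_num at h
    refine h.congr fun n => ?_
    rw [ncard_latWindow_gridPoint]
    simp only [Pi.div_apply]
    push_cast
    field_simp
  · filter_upwards [eventually_gt_atTop 0] with n hn
    positivity

theorem exists_error_grid (d : ℕ) (hd : 2 ≤ d) :
    ∃ ε : ℕ → ℝ, Tendsto ε atTop (𝓝 0) ∧ ∀ᶠ n : ℕ in atTop,
      ((d : ℝ) ^ 2 - d) / (4 * (d : ℝ) ^ 2 - 4 * d - 3) *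
          ((numEdges (tiling 4 n) : ℝ) / (numEdges (tiling 4 d) : ℝ)) * (1 - ε n) ≤
        (cl (tiling 4 n) (tiling 4 d) : ℝ) ∧
      (cl (tiling 4 n) (tiling 4 d) : ℝ) ≤
        ((d : ℝ) ^ 2 - d) / (4 * (d : ℝ) ^ 2 - 8 * d + 5) *
          ((numEdges (tiling 4 n) : ℝ) / (numEdges (tiling 4 d) : ℝ)) * (1 + ε n) := by
  obtain ⟨lo, hi, h₁, h₂, h₃⟩ := exists_bounds_grid d hd
  have hd' : (2 : ℝ) ≤ d := by exact_mod_cast hd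
  have hA : 0 < 4 * (d : ℝ) ^ 2 - 4 * d - 3 := by nlinarith
  have hB : 0 < 4 * (d : ℝ) ^ 2 - 8 * d + 5 := by nlinarith
  have hC : 0 < (d : ℝ) ^ 2 - d := by nlinarith
  have hEd : (numEdges (tiling 4 d) : ℝ) = 2 * ((d : ℝ) ^ 2 - d) := by
    rw [numEdges_grid d (by omega), Nat.cast_mul, Nat.cast_mul, Nat.cast_sub (by omega)]
    push_cast
    ring
  set A := 4 * (d : ℝ) ^ 2 - 4 * d - 3
  set B := 4 * (d : ℝ) ^ 2 - 8 * d + 5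
  set E : ℕ → ℝ := fun n => (numEdges (tiling 4 n) : ℝ) / (latWindow gridPoint n).ncard with hE
  have hElim : Tendsto E atTop (𝓝 2) := tendsto_numEdges_grid
  have t₁ : Tendsto (fun n => 1 - lo n * (2 * A) / E n) atTop (𝓝 0) := by
    have h := ((h₁.mul_const (2 * A)).div hElim two_ne_zero).const_sub 1
    have hl : 1 - 1 / A * (2 * A) / 2 = 0 := by
      field_simp
      norm_num
    rw [hl] at h
    exact h
  have t₂ : Tendsto (fun n => hi n * (2 * B) / E n - 1) atTop (𝓝 0) := by
    have h := ((h₂.mul_const (2 * B)).div hElim two_ne_zero).sub_const 1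
    have hl : 1 / B * (2 * B) / 2 - 1 = 0 := by
      field_simp
      norm_num
    rw [hl] at h
    exact h
  -- Each term is the relative error of one of the two bounds; their sum dominates both, so a single
  -- `ε` serves.
  refine ⟨fun n => |1 - lo n * (2 * A) / E n| + |hi n * (2 * B) / E n - 1|, ?_, ?_⟩
  · have h := t₁.abs.add t₂.abs
    rwa [abs_zero, add_zero] at h
  · filter_upwards [isFolner_grid.pos, hElim.eventually (lt_mem_nhds zero_lt_two)] with n hn hEn
    have hW : (0 : ℝ) < (latWindow gridPoint n).ncard := by exact_mod_cast hn
    have hnum : (numEdges (tiling 4 n) : ℝ) = E n * (latWindow gridPoint n).ncard := by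
      simp only [hE]
      field_simp
    obtain ⟨hlo, hhi⟩ := h₃ n
    rw [le_div_iff₀ hW] at hlo
    rw [div_le_iff₀ hW] at hhi
    have a₁ := le_abs_self (1 - lo n * (2 * A) / E n)
    have a₂ := le_abs_self (hi n * (2 * B) / E n - 1)
    have a₃ := abs_nonneg (1 - lo n * (2 * A) / E n)
    have a₄ := abs_nonneg (hi n * (2 * B) / E n - 1)
    rw [hEd, hnum]
    -- The factor `d² - d` cancels against the edge number of the block, leaving half the edge
    -- density divided by `X`, times the window size.
    have c : ∀ X : ℝ, ((d : ℝ) ^ 2 - d) / X *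
        (E n * (latWindow gridPoint n).ncard / (2 * ((d : ℝ) ^ 2 - d))) =
        E n / (2 * X) * (latWindow gridPoint n).ncard := fun X => by
      have hC' := hC.ne'
      generalize (d : ℝ) ^ 2 - d = Y at hC'
      field_simp
    rw [c, c]
    constructor
    · refine le_trans ?_ hlo
      calc _ ≤ E n / (2 * A) * (latWindow gridPoint n).ncard * (lo n * (2 * A) / E n) := by
            gcongr
            linarith
        _ = _ := by field_simp
    · refine hhi.trans ?_
      calc _ = E n / (2 * B) * (latWindow gridPoint n).ncard * (hi n * (2 * B) / E n) := by
            field_simp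
        _ ≤ _ := by
            gcongr
            linarith

end ClumsyPacking

theorem theorem3 :
    -- the limits exist and have the stated values
    (∀ k : ℕ, k = 3 ∨ k = 4 ∨ k = 6 →
      Tendsto
        (fun n : ℕ =>
          (k : ℝ) * (ClumsyPacking.cl (ClumsyPacking.tiling k n) (SimpleGraph.cycleGraph k) : ℝ) /
            (ClumsyPacking.numEdges (ClumsyPacking.tiling k n) : ℝ))
        atTop (𝓝 (2 / ((k : ℝ) + 1)))) ∧
    -- the square grid
    (fun n : ℕ =>
        (ClumsyPacking.cl (ClumsyPacking.tiling 4 n) (SimpleGraph.cycleGraph 4) : ℝ))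
      ~[atTop] (fun n : ℕ => (n : ℝ) ^ 2 / 5) ∧
    -- packings of the square grid by smaller square grids
    (∀ d : ℕ, 2 ≤ d →
      ∃ ε : ℕ → ℝ, Tendsto ε atTop (𝓝 0) ∧
        ∀ᶠ n : ℕ in atTop,
          ((d : ℝ) ^ 2 - d) / (4 * (d : ℝ) ^ 2 - 4 * d - 3) *
              ((ClumsyPacking.numEdges (ClumsyPacking.tiling 4 n) : ℝ) /
                (ClumsyPacking.numEdges (ClumsyPacking.tiling 4 d) : ℝ)) * (1 - ε n) ≤
            (ClumsyPacking.cl (ClumsyPacking.tiling 4 n) (ClumsyPacking.tiling 4 d) : ℝ) ∧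
          (ClumsyPacking.cl (ClumsyPacking.tiling 4 n) (ClumsyPacking.tiling 4 d) : ℝ) ≤
            ((d : ℝ) ^ 2 - d) / (4 * (d : ℝ) ^ 2 - 8 * d + 5) *
              ((ClumsyPacking.numEdges (ClumsyPacking.tiling 4 n) : ℝ) /
                (ClumsyPacking.numEdges (ClumsyPacking.tiling 4 d) : ℝ)) * (1 + ε n)) := by
  refine ⟨?_, ClumsyPacking.isEquivalent_cl_four, ClumsyPacking.exists_error_grid⟩
  rintro k (rfl | rfl | rfl)
  · convert ClumsyPacking.tendsto_mul_div ClumsyPacking.isFolner_tri ((3 : ℕ) : ℝ)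
      ClumsyPacking.tendsto_cl_three ClumsyPacking.tendsto_numEdges_tri (by norm_num) using 2
    norm_num
  · convert ClumsyPacking.tendsto_mul_div ClumsyPacking.isFolner_grid ((4 : ℕ) : ℝ)
      ClumsyPacking.tendsto_cl_four ClumsyPacking.tendsto_numEdges_grid (by norm_num) using 2
    norm_num
  · convert ClumsyPacking.tendsto_mul_div ClumsyPacking.isFolner_tri ((6 : ℕ) : ℝ)
      ClumsyPacking.tendsto_cl_six ClumsyPacking.tendsto_numEdges_hex (by norm_num) using 2
    norm_num
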